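/- Let $\lambda,c>0$. The symmetric Markov random flight $\mathbf X(t)$ in $\mathbb R^4$ with speed $c$ and switching intensity $\lambda$ is the motion of a particle that starts at the origin at time $0$ in a direction uniformly distributed on the unit sphere, moves with constant speed $c$, and at each event of a homogeneous Poisson process of rate $\lambda$ takes on a new direction, uniformly distributed on the unit sphere and independent of everything before. Let $a>0$, $\varrho>0$, and consider such random flights, observed at times $t>0$, along any family of parameters $(\lambda,c,t)$ that satisfies the slow diffusion condition $$\lambda\to 0,\qquad c\to 0,\qquad t\to\infty,\qquad \lambda t\to a,\qquad ct\to\varrho .$$ Put $$q^{(ac)}(\mathbf x)=\frac{a}{\pi^2\varrho^4}\left[2+a\left(1-\frac{\|\mathbf x\|^2}{\varrho^2}\right)\right]\exp\left(-\frac{a}{\varrho^2}\|\mathbf x\|^2\right)\ \text{ if }\|\mathbf x\|<\varrho,\qquad q^{(ac)}(\mathbf x)=0\ \text{ if }\|\mathbf x\|\ge\varrho,$$ and let $\sigma_\varrho$ be the uniform probability distribution on the sphere $\{\|\mathbf x\|=\varrho\}$ in $\mathbb R^4$. Then the measure $$Q(d\mathbf x)=e^{-a}\,\sigma_\varrho(d\mathbf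 x)+q^{(ac)}(\mathbf x)\,d\mathbf x$$ is a probability distribution on $\mathbb R^4$, and the transition density of $\mathbf X(t)$ converges to the density of $Q$ in the following sense. 1. The distribution of $\mathbf X(t)$ converges weakly to $Q$. 2. The singular component (with respect to Lebesgue measure) of the distribution of $\mathbf X(t)$ converges weakly to $e^{-a}\sigma_\varrho$. 3. For all $\lambda,c,t>0$ the absolutely continuous component of the distribution of $\mathbf X(t)$ has a density $p^{(ac)}(\cdot,t)\ge 0$ that is continuous in the open ball $\{\|\mathbf x\|<ct\}$ and vanishes outside it, and $p^{(ac)}(\mathbf x,t)\to q^{(ac)}(\mathbf x)$ for every $\mathbf x\in\mathbb R^4$ with $\|\mathbf x\|\ne\varrho$. -/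

import Mathlib

open MeasureTheory ProbabilityTheory Filter Topology
open scoped ENNReal BoundedContinuousFunction

noncomputable section

/-- The uniform probability law on the sphere of radius `r` centred at the origin of `ℝᵐ`, as a
measure on `ℝᵐ`: the normalised surface measure of the unit sphere, pushed forward by `u ↦ r u`. -/
def uniformSphere (m : ℕ) (r : ℝ) : Measure (EuclideanSpace ℝ (Fin m)) :=
  Measure.map (fun u : Metric.sphere (0 : EuclideanSpace ℝ (Fin m)) 1 =>
      r • (u : EuclideanSpace ℝ (Fin m)))
    (((volume : Measure (EuclideanSpace ℝ (Fin m))).toSphere Set.univ)⁻¹ •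
      (volume : Measure (EuclideanSpace ℝ (Fin m))).toSphere)

/-- A realisation, on the probability space `(Ω, P)`, of the randomness that drives the symmetric
Markov random flight in `ℝᵐ` with switching intensity `lam`: the waiting times
`wait 0, wait 1, …` between successive events of a homogeneous Poisson process of rate `lam`
(i.i.d. exponential), and the directions `dir 0, dir 1, …` (i.i.d. uniform on the unit sphere),
all of these variables being mutually independent. The direction `dir k` is followed during the
time interval of length `wait k` that ends at the `(k+1)`-st Poisson event. -/
structure RandomFlight {Ω : Type*} [MeasurableSpace Ω] (P : Measure Ω) (m : ℕ) (lam : ℝ) where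
  wait : ℕ → Ω → ℝ
  dir : ℕ → Ω → EuclideanSpace ℝ (Fin m)
  measurable_wait : ∀ k, Measurable (wait k)
  measurable_dir : ∀ k, Measurable (dir k)
  /-- `wait k` is exponential of rate `lam`, `dir k` is uniform on the unit sphere, and the two
  are independent. -/
  law_pair : ∀ k, P.map (fun ω => (wait k ω, dir k ω)) = (expMeasure lam).prod (uniformSphere m 1)
  /-- The pairs `(wait k, dir k)`, `k = 0, 1, …`, are mutually independent. -/
  indep : iIndepFun (fun k ω => (wait k ω, dir k ω)) P

namespace RandomFlight

variable {Ω : Type*} [MeasurableSpace Ω] {P : Measure Ω} {m : ℕ} {lam : ℝ}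

/-- The time of the `k`-th Poisson event (`arrival 0 = 0` is the start of the motion). -/
def arrival (F : RandomFlight P m lam) (k : ℕ) (ω : Ω) : ℝ :=
  ∑ j ∈ Finset.range k, F.wait j ω

/-- The number of Poisson events up to time `t`. -/
def count (F : RandomFlight P m lam) (t : ℝ) (ω : Ω) : ℕ :=
  {k : ℕ | F.arrival (k + 1) ω ≤ t}.ncard

/-- The position at time `t` of the particle that starts at the origin and moves with speed `c`:
the completed legs, plus the current leg, which started at the last Poisson event before `t`. -/
def position (F : RandomFlight P m lam) (c t : ℝ) (ω : Ω) : EuclideanSpace ℝ (Fin m) :=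
  (∑ k ∈ Finset.range (F.count t ω), (c * F.wait k ω) • F.dir k ω) +
    (c * (t - F.arrival (F.count t ω) ω)) • F.dir (F.count t ω) ω

/-- The distribution of the position at time `t`. -/
def law (F : RandomFlight P m lam) (c t : ℝ) : Measure (EuclideanSpace ℝ (Fin m)) :=
  P.map (F.position c t)

end RandomFlight

/-- `f` is the density of the absolutely continuous component of `μ`, in its version that is
continuous in the open ball of radius `r` and vanishes outside it (there is at most one). -/
structure IsACDensity {m : ℕ} (μ : Measure (EuclideanSpace ℝ (Fin m))) (r : ℝ)
    (f : EuclideanSpace ℝ (Fin m) → ℝ) : Prop where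
  continuousOn : ContinuousOn f (Metric.ball 0 r)
  nonneg : ∀ x, 0 ≤ f x
  eq_zero : ∀ x, r ≤ ‖x‖ → f x = 0
  decomposition : μ = μ.singularPart volume + volume.withDensity (fun x => ENNReal.ofReal (f x))

/-- The absolutely continuous part of the stationary density in `ℝ⁴`. -/
def stationaryACDensity (a ϱ : ℝ) (x : EuclideanSpace ℝ (Fin 4)) : ℝ :=
  if ‖x‖ < ϱ then
    a / (Real.pi ^ 2 * ϱ ^ 4) * (2 + a * (1 - ‖x‖ ^ 2 / ϱ ^ 2)) *
      Real.exp (-(a / ϱ ^ 2) * ‖x‖ ^ 2)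
  else 0

/-- The singular part of the stationary distribution in `ℝ⁴`. -/
def stationarySingularPart (a ϱ : ℝ) : Measure (EuclideanSpace ℝ (Fin 4)) :=
  ENNReal.ofReal (Real.exp (-a)) • uniformSphere 4 ϱ

/-- The stationary distribution in `ℝ⁴`. -/
def stationaryLaw (a ϱ : ℝ) : Measure (EuclideanSpace ℝ (Fin 4)) :=
  stationarySingularPart a ϱ +
    volume.withDensity (fun x => ENNReal.ofReal (stationaryACDensity a ϱ x))

end

/-! In dimension four the law of the flight is explicit: it is exactly Q with a = λt and ϱ = ct
(`RandomFlight.law_eq_stationaryLaw`). The three limits then reduce to continuity of Q, of its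
singular part and of its density in the pair (a, ϱ).

The identity is proved with characteristic functions. On the event of n switches up to time t, the
transform of the position is λ^n e^{-λt} times the (n+1)-fold convolution in time of the transform
of the uniform law on the sphere of radius cs (`RandomFlight.setIntegral_countEvent`). For radius s
and z = ‖ξ‖/2 that transform is ∑ (-z²)^k s^{2k} / (k! (k+1)!) = ∑ (-z²)^k C_k s^{2k} / (2k)!, with
C_k the Catalan numbers. Since s^p/p! and s^q/q! convolve to s^{p+q+1}/(p+q+1)!, convolution powers
become powers of the Catalan series, whose coefficients are explicit ballot numbers
(`integral_flightKernel_mul`, `ballotCoeff_mul_factorial`).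

On the side of Q, put y = a(1 - r²/ϱ²). Up to a constant the density is e^{-a}(2 + y)e^y = e^{-a} ∑
(n+2) y^n/n!. In polar coordinates, beta integrals show that the n-th term has the transform of
exactly n+1 switches (`hasSum_integral_radial`). The sphere carries the case of no switch. -/

section

open scoped Nat

/-! ### Ballot numbers as coefficients of powers of the Catalan series -/

open PowerSeries in
theorem catalanSeries_pow_succ (m : ℕ) :
    catalanSeries ^ (m + 1) = catalanSeries ^ m + X * catalanSeries ^ (m + 2) := by
  have h := catalanSeries_sq_mul_X_add_one
  calc catalanSeries ^ (m + 1) = catalanSeries ^ m * catalanSeries := pow_succ _ _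
    _ = catalanSeries ^ m * (catalanSeries ^ 2 * X + 1) := by rw [h]
    _ = _ := by ring

/-- The coefficients of the powers of the Catalan series (ballot numbers). -/
noncomputable def ballotCoeff (m k : ℕ) : ℕ := PowerSeries.coeff k (PowerSeries.catalanSeries ^ m)

theorem ballotCoeff_succ_succ (m k : ℕ) :
    ballotCoeff (m + 1) (k + 1) = ballotCoeff m (k + 1) + ballotCoeff (m + 2) k := by
  unfold ballotCoeff
  rw [catalanSeries_pow_succ, map_add, PowerSeries.coeff_succ_X_mul]

/-- The recurrence coming from C = 1 + X C² lowers either k or m, so the closed form follows by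
induction on k for all m, with an inner induction on m that starts from C^0 = 1. -/
theorem ballotCoeff_mul_factorial (k m : ℕ) :
    ballotCoeff (m + 1) k * (k ! * (m + 1 + k)!) = (m + 1) * (m + 2 * k)! := by
  induction k generalizing m with
  | zero => simp [ballotCoeff, Nat.factorial_succ]
  | succ k ihk =>
    induction m with
    | zero =>
      have h0 : ballotCoeff 0 (k + 1) = 0 := by simp [ballotCoeff, PowerSeries.coeff_one]
      have h1 := ihk 1
      rw [ballotCoeff_succ_succ, h0]
      rw [show 0 + 2 * (k + 1) = (1 + 2 * k) + 1 by ring, Nat.factorial_succ (1 + 2 * k),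
        show 0 + 1 + (k + 1) = 1 + 1 + k by ring, Nat.factorial_succ k]
      linear_combination (k + 1) * h1
    | succ m ihm =>
      have h1 := ihk (m + 2)
      rw [ballotCoeff_succ_succ]
      rw [show m + 2 * (k + 1) = m + 2 + 2 * k by ring, Nat.factorial_succ k] at ihm
      rw [show m + 1 + 2 * (k + 1) = (m + 2 + 2 * k) + 1 by ring,
        Nat.factorial_succ (m + 2 + 2 * k),
        show m + 1 + 1 + (k + 1) = (m + 1 + (k + 1)) + 1 by ring,
        Nat.factorial_succ (m + 1 + (k + 1)), Nat.factorial_succ k]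
      rw [show m + 2 + 1 + k = (m + 1 + (k + 1)) + 1 by ring,
        Nat.factorial_succ (m + 1 + (k + 1))] at h1
      linear_combination (m + 1 + (k + 1) + 1) * ihm + (k + 1) * h1

theorem ballotCoeff_succ (m k : ℕ) :
    ballotCoeff (m + 1) k = ∑ p ∈ Finset.HasAntidiagonal.antidiagonal k, ballotCoeff 1 p.1 * ballotCoeff m p.2 := by
  unfold ballotCoeff
  rw [pow_succ', PowerSeries.coeff_mul, pow_one]

theorem ballotCoeff_div_factorial (m k : ℕ) :
    (ballotCoeff (m + 1) k : ℝ) / (m + 2 * k)! = (m + 1) / (k ! * (m + 1 + k)!) := by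
  have h := ballotCoeff_mul_factorial k m
  rw [div_eq_div_iff (by positivity) (by positivity)]
  exact_mod_cast h

/-- Separating the two indices lets exponential series dominate all the power series below. -/
theorem ballotCoeff_div_factorial_le (m k : ℕ) :
    (ballotCoeff (m + 1) k : ℝ) / (m + 2 * k)! ≤ 1 / (k ! * m !) := by
  rw [ballotCoeff_div_factorial]
  rw [div_le_div_iff₀ (by positivity) (by positivity), one_mul]
  have h : (m + 1) * m ! ≤ (m + 1 + k)! := by
    rw [← Nat.factorial_succ]; exact Nat.factorial_le (by omega)
  have h' : ((m : ℝ) + 1) * m ! ≤ (m + 1 + k)! := by exact_mod_cast h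
  nlinarith [Nat.cast_nonneg (α := ℝ) (k !)]

/-! ### Convolution powers of the sphere transform as power series -/

theorem hasSum_intervalIntegral_of_bound {ι : Type*} [Countable ι] {f : ι → ℝ → ℝ} {F : ℝ → ℝ}
    {u : ι → ℝ} {a b : ℝ} (hab : a ≤ b) (hf : ∀ i, Continuous (f i)) (hu : Summable u)
    (hb : ∀ i, ∀ x ∈ Set.Icc a b, |f i x| ≤ u i)
    (hF : ∀ x ∈ Set.Icc a b, HasSum (fun i => f i x) (F x)) :
    HasSum (fun i => ∫ x in a..b, f i x) (∫ x in a..b, F x) := by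
  have hI : ∀ x ∈ Set.uIoc a b, x ∈ Set.Icc a b := fun x hx => by
    rw [Set.uIoc_of_le hab] at hx; exact Set.Ioc_subset_Icc_self hx
  refine intervalIntegral.hasSum_integral_of_dominated_convergence (fun i _ => u i)
    (fun i => (hf i).aestronglyMeasurable) (fun i => ?_) ?_ ?_ ?_
  · exact ae_of_all _ fun x hx => hb i x (hI x hx)
  · exact ae_of_all _ fun x _ => hu
  · exact intervalIntegrable_const
  · exact ae_of_all _ fun x hx => hF x (hI x hx)

theorem integral_pow_mul_sub_pow (u : ℝ) (p q : ℕ) :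
    ∫ s in (0 : ℝ)..u, s ^ p * (u - s) ^ q = p ! * q ! * u ^ (p + q + 1) / (p + q + 1)! := by
  induction q generalizing p with
  | zero =>
    simp only [pow_zero, mul_one, integral_pow, add_zero, Nat.factorial_succ, Nat.factorial_zero]
    push_cast
    field_simp
    simp
  | succ q ih =>
    have h := intervalIntegral.integral_mul_deriv_eq_deriv_mul (a := 0) (b := u)
      (u := fun s : ℝ => (u - s) ^ (q + 1)) (u' := fun s => -((q + 1) * (u - s) ^ q))
      (v := fun s : ℝ => s ^ (p + 1) / (p + 1)) (v' := fun s => s ^ p)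
      (fun x _ => by
        convert! ((hasDerivAt_id x).const_sub u).fun_pow (q + 1) using 1
        push_cast
        simp)
      (fun x _ => by
        have := (hasDerivAt_pow (p + 1) x).div_const ((p : ℝ) + 1)
        convert this using 1
        push_cast
        field_simp)
      (by apply Continuous.intervalIntegrable; fun_prop)
      (by apply Continuous.intervalIntegrable; fun_prop)
    have e1 : ∀ s : ℝ, s ^ p * (u - s) ^ (q + 1) = (u - s) ^ (q + 1) * s ^ p := fun s => mul_comm _ _
    simp_rw [e1]
    rw [h]
    have e2 : ∀ s : ℝ, -((q + 1) * (u - s) ^ q) * (s ^ (p + 1) / (p + 1)) =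
        -((q + 1) / (p + 1)) * (s ^ (p + 1) * (u - s) ^ q) := fun s => by ring
    simp_rw [e2]
    rw [intervalIntegral.integral_const_mul, ih (p + 1), show p + 1 + q + 1 = p + (q + 1) + 1 by ring,
      Nat.factorial_succ p, Nat.factorial_succ q]
    push_cast
    have : (p : ℝ) + 1 ≠ 0 := by positivity
    field_simp
    simp

/-- The terms of the power series of `flightKernel`. -/
noncomputable def flightTerm (z : ℝ) (n k : ℕ) (s : ℝ) : ℝ :=
  (-z ^ 2) ^ k * (ballotCoeff (n + 1) k / (n + 2 * k)!) * s ^ (n + 2 * k)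

/-- The `(n + 1)`-fold convolution power, in the time `s`, of the characteristic function of the
uniform law on the sphere of radius `s` in `ℝ⁴` at a frequency of norm `2 z`
(see `charFun_uniformSphere` and `integral_flightKernel_mul`). -/
noncomputable def flightKernel (z : ℝ) (n : ℕ) (s : ℝ) : ℝ := ∑' k, flightTerm z n k s

theorem continuous_flightTerm (z : ℝ) (n k : ℕ) : Continuous (flightTerm z n k) := by
  unfold flightTerm; fun_prop

theorem abs_flightTerm_le {z s R : ℝ} (hs : |s| ≤ R) (n k : ℕ) :
    |flightTerm z n k s| ≤ (R ^ n / n !) * ((z ^ 2 * R ^ 2) ^ k / k !) := by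
  have hR : 0 ≤ R := (abs_nonneg _).trans hs
  unfold flightTerm
  rw [abs_mul, abs_mul, abs_pow, abs_neg, abs_of_nonneg (sq_nonneg z), abs_pow,
    abs_of_nonneg (by positivity)]
  calc (z ^ 2) ^ k * ((ballotCoeff (n + 1) k : ℝ) / (n + 2 * k)!) * |s| ^ (n + 2 * k)
      ≤ (z ^ 2) ^ k * (1 / (k ! * n !)) * R ^ (n + 2 * k) := by
        have := ballotCoeff_div_factorial_le n k
        refine mul_le_mul (mul_le_mul_of_nonneg_left this (by positivity))
          (pow_le_pow_left₀ (abs_nonneg _) hs _) (by positivity) (by positivity)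
    _ = _ := by field_simp; ring

theorem summable_flightBound (z R : ℝ) (n : ℕ) :
    Summable fun k : ℕ => (R ^ n / n !) * ((z ^ 2 * R ^ 2) ^ k / k !) :=
  (Real.summable_pow_div_factorial _).mul_left _

theorem exists_summable_flightTerm_le (z R : ℝ) (n : ℕ) (hR : 0 ≤ R) :
    ∃ A : ℕ → ℝ, Summable A ∧ 0 ≤ A ∧ ∀ k s, |s| ≤ R → |flightTerm z n k s| ≤ A k :=
  ⟨_, summable_flightBound z R n, fun k => by positivity, fun k _ hs => abs_flightTerm_le hs n k⟩

theorem hasSum_flightKernel (z : ℝ) (n : ℕ) (s : ℝ) :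
    HasSum (fun k => flightTerm z n k s) (flightKernel z n s) :=
  ((summable_flightBound z |s| n).of_norm_bounded fun k => abs_flightTerm_le le_rfl n k).hasSum

theorem continuous_flightKernel (z : ℝ) (n : ℕ) : Continuous (flightKernel z n) := by
  rw [continuous_iff_continuousAt]
  intro x
  have hc : ContinuousOn (flightKernel z n) (Set.Icc (-(|x| + 1)) (|x| + 1)) :=
    continuousOn_tsum (fun k => (continuous_flightTerm z n k).continuousOn)
      (summable_flightBound z (|x| + 1) n) fun k s hs => abs_flightTerm_le (abs_le.2 hs) n k
  refine hc.continuousAt (Icc_mem_nhds ?_ ?_)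
  · linarith [neg_abs_le x]
  · linarith [le_abs_self x]

theorem flightKernel_zero (n : ℕ) (s : ℝ) : flightKernel 0 n s = s ^ n / n ! := by
  refine (hasSum_flightKernel 0 n s).unique ?_
  convert! hasSum_single (f := fun k => flightTerm 0 n k s) 0 ?_ using 1
  · simp [flightTerm, ballotCoeff]
    ring
  · intro k hk
    simp [flightTerm, hk]

theorem flightKernel_scale (c z : ℝ) (n : ℕ) (s : ℝ) :
    flightKernel z n (c * s) = c ^ n * flightKernel (c * z) n s := by
  refine (hasSum_flightKernel z n (c * s)).unique ?_
  convert! (hasSum_flightKernel (c * z) n s).mul_left (c ^ n) using 2 with k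
  unfold flightTerm
  rw [mul_pow c s, mul_pow c z, neg_mul_eq_mul_neg, mul_pow (c ^ 2), pow_add, pow_mul c 2 k]
  ring

theorem integral_flightTerm_mul (z : ℝ) (n i j : ℕ) (u : ℝ) :
    ∫ w in (0 : ℝ)..u, flightTerm z 0 i w * flightTerm z n j (u - w) =
      (-z ^ 2) ^ (i + j) * (ballotCoeff 1 i * ballotCoeff (n + 1) j : ℕ) *
        u ^ (n + 1 + 2 * (i + j)) / (n + 1 + 2 * (i + j))! := by
  have e : ∀ w, flightTerm z 0 i w * flightTerm z n j (u - w) =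
      (-z ^ 2) ^ (i + j) * (ballotCoeff 1 i * ballotCoeff (n + 1) j : ℕ) / ((2 * i)! * (n + 2 * j)!) *
        (w ^ (2 * i) * (u - w) ^ (n + 2 * j)) := fun w => by
    unfold flightTerm
    push_cast
    simp only [zero_add]
    field_simp
    ring
  simp_rw [e]
  rw [intervalIntegral.integral_const_mul, integral_pow_mul_sub_pow,
    show 2 * i + (n + 2 * j) + 1 = n + 1 + 2 * (i + j) by ring]
  field_simp

theorem HasSum.sum_antidiagonal {f : ℕ × ℕ → ℝ} {S : ℝ} (h : HasSum f S) :
    HasSum (fun k => ∑ p ∈ Finset.HasAntidiagonal.antidiagonal k, f p) S := by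
  rw [← Finset.HasAntidiagonal.sigmaAntidiagonalEquivProd.hasSum_iff] at h
  convert! h.sigma (fun k => hasSum_fintype _) using 2 with k
  exact (Finset.sum_coe_sort (Finset.HasAntidiagonal.antidiagonal k) f).symm

/-- Monomials divided by factorials convolve to such monomials, so the convolution of the two series
is a Cauchy product of coefficients, and C · C^{n+1} = C^{n+2}. -/
theorem integral_flightKernel_mul (z : ℝ) (n : ℕ) {u : ℝ} (hu : 0 ≤ u) :
    ∫ w in (0 : ℝ)..u, flightKernel z 0 w * flightKernel z n (u - w) =
      flightKernel z (n + 1) u := by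
  obtain ⟨A, hA, hA0, hAb⟩ := exists_summable_flightTerm_le z u 0 hu
  obtain ⟨B, hB, hB0, hBb⟩ := exists_summable_flightTerm_le z u n hu
  have hsum : Summable fun p : ℕ × ℕ => A p.1 * B p.2 := hA.mul_of_nonneg hB hA0 hB0
  have hle : ∀ x ∈ Set.Icc 0 u, |x| ≤ u ∧ |u - x| ≤ u := fun x hx => by
    rw [abs_le, abs_le]; constructor <;> constructor <;> linarith [hx.1, hx.2]
  have hbound : ∀ p : ℕ × ℕ, ∀ x ∈ Set.Icc 0 u,
      |flightTerm z 0 p.1 x * flightTerm z n p.2 (u - x)| ≤ A p.1 * B p.2 := fun p x hx => by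
    rw [abs_mul]
    exact mul_le_mul (hAb _ _ (hle x hx).1) (hBb _ _ (hle x hx).2) (abs_nonneg _) (hA0 _)
  have h := hasSum_intervalIntegral_of_bound (ι := ℕ × ℕ)
    (f := fun p w => flightTerm z 0 p.1 w * flightTerm z n p.2 (u - w))
    (F := fun w => flightKernel z 0 w * flightKernel z n (u - w)) hu
    (fun p => (continuous_flightTerm z 0 p.1).mul
      ((continuous_flightTerm z n p.2).comp (by fun_prop))) hsum hbound
    (fun x hx => (hasSum_flightKernel z 0 x).mul (hasSum_flightKernel z n (u - x))
      (hsum.of_norm_bounded fun p => hbound p x hx))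
  simp_rw [integral_flightTerm_mul] at h
  -- The double series over (i, j) is regrouped by k = i + j, the power of -z².
  refine (HasSum.sum_antidiagonal h).unique ?_
  convert! hasSum_flightKernel z (n + 1) u using 2 with k
  unfold flightTerm
  rw [ballotCoeff_succ, Nat.cast_sum, Finset.sum_div, Finset.mul_sum, Finset.sum_mul]
  refine Finset.sum_congr rfl fun p hp => ?_
  rw [Finset.HasAntidiagonal.mem_antidiagonal.1 hp]
  ring

theorem Real.hasSum_pow_div_factorial (x : ℝ) : HasSum (fun n : ℕ => x ^ n / n !) (Real.exp x) := by
  rw [Real.exp_eq_exp_ℝ]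
  exact NormedSpace.expSeries_div_hasSum_exp x

theorem abs_flightKernel_le {z s R : ℝ} (hs : |s| ≤ R) (n : ℕ) :
    |flightKernel z n s| ≤ (R ^ n / n !) * Real.exp (z ^ 2 * R ^ 2) := by
  have h : HasSum (fun k : ℕ => (R ^ n / n !) * ((z ^ 2 * R ^ 2) ^ k / k !))
      ((R ^ n / n !) * Real.exp (z ^ 2 * R ^ 2)) :=
    (Real.hasSum_pow_div_factorial _).mul_left _
  exact tsum_of_norm_bounded h fun k =>
    (Real.norm_eq_abs (flightTerm z n k s)).trans_le (abs_flightTerm_le hs n k)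

/-! ### Gaussian moments, polar coordinates and the transform of the sphere in ℝ⁴ -/

theorem integral_Ioi_pow_mul_exp_neg_sq (n : ℕ) :
    ∫ x in Set.Ioi (0 : ℝ), x ^ n * Real.exp (-x ^ 2) = Real.Gamma ((n + 1) / 2) / 2 := by
  have h := integral_rpow_mul_exp_neg_rpow (p := 2) (q := n) (by norm_num)
    (by linarith [Nat.cast_nonneg (α := ℝ) n])
  rw [div_eq_mul_one_div, mul_comm, ← h]
  refine setIntegral_congr_fun measurableSet_Ioi fun x hx => ?_
  simp [Real.rpow_natCast]

theorem integral_pow_two_mul_mul_exp_neg_sq (k : ℕ) :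
    ∫ x : ℝ, x ^ (2 * k) * Real.exp (-x ^ 2) = Real.Gamma (k + 1 / 2) := by
  have h := integral_comp_abs (f := fun x : ℝ => x ^ (2 * k) * Real.exp (-x ^ 2))
  simp only [pow_mul, sq_abs] at h
  simp only [pow_mul]
  rw [h]
  have h2 := integral_Ioi_pow_mul_exp_neg_sq (2 * k)
  simp only [pow_mul] at h2
  rw [h2]
  push_cast
  rw [show (2 * (k : ℝ) + 1) / 2 = k + 1 / 2 by ring]
  ring

theorem integral_pow_two_mul_add_one_mul_exp_neg_sq (k : ℕ) :
    ∫ x : ℝ, x ^ (2 * k + 1) * Real.exp (-x ^ 2) = 0 := by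
  have h := integral_neg_eq_self (fun x : ℝ => x ^ (2 * k + 1) * Real.exp (-x ^ 2)) volume
  have e : ∀ x : ℝ, (-x) ^ (2 * k + 1) * Real.exp (-(-x) ^ 2) =
      -(x ^ (2 * k + 1) * Real.exp (-x ^ 2)) := fun x => by
    rw [Odd.neg_pow ⟨k, rfl⟩, neg_sq]; ring
  simp only [e, integral_neg] at h
  linarith

theorem integrable_pow_mul_exp_neg_sq (n : ℕ) :
    Integrable fun x : ℝ => x ^ n * Real.exp (-x ^ 2) := by
  have h := integrable_rpow_mul_exp_neg_mul_sq (b := 1) one_pos (s := n)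
    (by linarith [Nat.cast_nonneg (α := ℝ) n])
  simpa [Real.rpow_natCast] using h

theorem Real.Gamma_nat_add_half_eq_factorial (k : ℕ) :
    Real.Gamma (k + 1 / 2) = (2 * k)! * √Real.pi / (4 ^ k * k !) := by
  induction k with
  | zero => simp [Real.Gamma_one_half_eq, -one_div]
  | succ k ih =>
    have : ((k + 1 : ℕ) : ℝ) + 1 / 2 = (k + 1 / 2) + 1 := by push_cast; ring
    rw [this, Real.Gamma_add_one (by positivity), ih, show 2 * (k + 1) = 2 * k + 1 + 1 by ring,
      Nat.factorial_succ, Nat.factorial_succ, Nat.factorial_succ k]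
    push_cast
    field_simp
    ring

theorem exists_orthonormalBasis_zero_inner (ξ : EuclideanSpace ℝ (Fin 4)) :
    ∃ b : OrthonormalBasis (Fin 4) ℝ (EuclideanSpace ℝ (Fin 4)),
      ∀ x, inner ℝ x ξ = ‖ξ‖ * b.repr x 0 := by
  rcases eq_or_ne ξ 0 with rfl | hξ
  · exact ⟨EuclideanSpace.basisFun (Fin 4) ℝ, fun x => by simp⟩
  · have hv : Orthonormal ℝ (({0} : Set (Fin 4)).domRestrict fun _ => ‖ξ‖⁻¹ • ξ) := by
      constructor
      · rintro ⟨i, hi⟩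
        simp [norm_smul, hξ]
      · rintro ⟨i, hi⟩ ⟨j, hj⟩ hij
        exact absurd (Subtype.ext (hi.trans hj.symm)) hij
    obtain ⟨b, hb⟩ := hv.exists_orthonormalBasis_extension_of_card_eq (by simp)
    refine ⟨b, fun x => ?_⟩
    rw [b.repr_apply_apply, hb 0 rfl, inner_smul_left, real_inner_comm]
    have : ‖ξ‖ ≠ 0 := by simpa using hξ
    simp
    field_simp

/-- After a rotation taking ξ to the first axis the integrand is a product over coordinates; the
other three each contribute √π. -/
theorem integrable_inner_pow_mul_exp_and_integral (ξ : EuclideanSpace ℝ (Fin 4)) (n : ℕ) :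
    Integrable (fun x : EuclideanSpace ℝ (Fin 4) => inner ℝ x ξ ^ n * Real.exp (-‖x‖ ^ 2)) ∧
    ∫ x : EuclideanSpace ℝ (Fin 4), inner ℝ x ξ ^ n * Real.exp (-‖x‖ ^ 2) =
      ‖ξ‖ ^ n * √Real.pi ^ 3 * ∫ x : ℝ, x ^ n * Real.exp (-x ^ 2) := by
  obtain ⟨b, hb⟩ := exists_orthonormalBasis_zero_inner ξ
  let w : Fin 4 → ℝ → ℝ := fun i x =>
    if i = 0 then ‖ξ‖ ^ n * (x ^ n * Real.exp (-x ^ 2)) else Real.exp (-x ^ 2)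
  let g : EuclideanSpace ℝ (Fin 4) → ℝ := fun y => (‖ξ‖ * y 0) ^ n * Real.exp (-‖y‖ ^ 2)
  have hfg : (fun x : EuclideanSpace ℝ (Fin 4) => inner ℝ x ξ ^ n * Real.exp (-‖x‖ ^ 2)) =
      g ∘ b.measurableEquiv := by
    ext x
    simp [g, hb, OrthonormalBasis.measurableEquiv]
  have hgw : g ∘ MeasurableEquiv.toLp 2 (Fin 4 → ℝ) = fun y : Fin 4 → ℝ => ∏ i, w i (y i) := by
    ext y
    simp only [g, w, Function.comp_def, EuclideanSpace.norm_sq_eq, Fin.prod_univ_four,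
      Fin.sum_univ_four]
    simp [Real.exp_add, mul_pow]
    ring
  have h1 : Integrable fun x : ℝ => Real.exp (-x ^ 2) := by
    simpa using integrable_pow_mul_exp_neg_sq 0
  have hw : ∀ i, Integrable (w i) := fun i => by
    by_cases hi : i = 0
    · simpa [w, hi] using (integrable_pow_mul_exp_neg_sq n).const_mul _
    · simpa [w, hi] using h1
  have hm := PiLp.volume_preserving_toLp (Fin 4)
  have hint : Integrable (g ∘ MeasurableEquiv.toLp 2 (Fin 4 → ℝ)) := by
    rw [hgw]; exact Integrable.fintype_prod hw
  constructor
  · rw [hfg, b.measurePreserving_measurableEquiv.integrable_comp_emb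
      b.measurableEquiv.measurableEmbedding]
    exact (hm.integrable_comp_emb (MeasurableEquiv.toLp 2 _).measurableEmbedding).1 hint
  · rw [hfg]
    simp only [Function.comp_def]
    rw [b.measurePreserving_measurableEquiv.integral_comp
      b.measurableEquiv.measurableEmbedding,
      ← hm.integral_comp (MeasurableEquiv.toLp 2 _).measurableEmbedding]
    have := congrArg (fun F : (Fin 4 → ℝ) → ℝ => ∫ y, F y) hgw
    refine this.trans ?_
    rw [integral_fintype_prod_volume_eq_prod w, Fin.prod_univ_four]
    have h2 : ∫ x : ℝ, Real.exp (-x ^ 2) = √Real.pi := by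
      simpa using integral_gaussian 1
    simp only [w, if_true, Fin.reduceEq, if_false, integral_const_mul, h2]
    ring

/-- The normalised surface measure on the unit sphere of `ℝᵐ`. -/
noncomputable def sphereLaw (m : ℕ) : Measure (Metric.sphere (0 : EuclideanSpace ℝ (Fin m)) 1) :=
  ((volume : Measure (EuclideanSpace ℝ (Fin m))).toSphere Set.univ)⁻¹ •
    (volume : Measure (EuclideanSpace ℝ (Fin m))).toSphere

theorem measurable_smul_sphere (m : ℕ) (r : ℝ) :
    Measurable fun u : Metric.sphere (0 : EuclideanSpace ℝ (Fin m)) 1 =>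
      r • (u : EuclideanSpace ℝ (Fin m)) := by fun_prop

instance isProbabilityMeasure_sphereLaw (m : ℕ) [NeZero m] :
    IsProbabilityMeasure (sphereLaw m) := by
  constructor
  have : Nonempty (Fin m) := ⟨⟨0, NeZero.pos m⟩⟩
  rw [sphereLaw, Measure.smul_apply, smul_eq_mul]
  refine ENNReal.inv_mul_cancel ?_ (measure_ne_top _ _)
  rw [Ne, Measure.measure_univ_eq_zero]
  exact Measure.toSphere_ne_zero _

theorem uniformSphere_eq_map (m : ℕ) (r : ℝ) :
    uniformSphere m r = (sphereLaw m).map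
      (fun u : Metric.sphere (0 : EuclideanSpace ℝ (Fin m)) 1 =>
        r • (u : EuclideanSpace ℝ (Fin m))) := rfl

instance isProbabilityMeasure_uniformSphere (m : ℕ) [NeZero m] (r : ℝ) :
    IsProbabilityMeasure (uniformSphere m r) := by
  rw [uniformSphere_eq_map]
  exact Measure.isProbabilityMeasure_map (measurable_smul_sphere m r).aemeasurable

theorem uniformSphere_eq_map_smul (m : ℕ) (r : ℝ) :
    uniformSphere m r = (uniformSphere m 1).map fun x => r • x := by
  rw [uniformSphere_eq_map, uniformSphere_eq_map,
    Measure.map_map (measurable_const_smul r) (measurable_smul_sphere m 1)]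
  simp [Function.comp_def]

theorem ae_norm_uniformSphere (m : ℕ) {r : ℝ} (hr : 0 ≤ r) :
    ∀ᵐ x ∂(uniformSphere m r), ‖x‖ = r := by
  rw [uniformSphere_eq_map, ae_map_iff (measurable_smul_sphere m r).aemeasurable
    (measurableSet_eq_fun measurable_norm measurable_const)]
  refine ae_of_all _ fun u => ?_
  simp [norm_smul, abs_of_nonneg hr]

theorem uniformSphere_mutuallySingular (m : ℕ) [NeZero m] {r : ℝ} (hr : 0 ≤ r) :
    Measure.MutuallySingular (uniformSphere m r) volume := by
  have : Nonempty (Fin m) := ⟨⟨0, NeZero.pos m⟩⟩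
  refine ⟨(Metric.sphere 0 r)ᶜ, Metric.isClosed_sphere.measurableSet.compl, ?_, ?_⟩
  · refine measure_mono_null (fun x hx => ?_) (ae_iff.1 (ae_norm_uniformSphere m hr))
    simpa using hx
  · rw [compl_compl]; exact Measure.addHaar_sphere _ _ _

theorem volume_real_ball_four :
    (volume : Measure (EuclideanSpace ℝ (Fin 4))).real (Metric.ball 0 1) = Real.pi ^ 2 / 2 := by
  rw [Measure.real, EuclideanSpace.volume_ball]
  have h : Real.Gamma (4 / 2 + 1) = 2 := by
    rw [show (4 : ℝ) / 2 + 1 = (2 : ℕ) + 1 by norm_num, Real.Gamma_nat_eq_factorial]; norm_num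
  have h2 : √Real.pi ^ 4 = Real.pi ^ 2 := by
    rw [show 4 = 2 * 2 by rfl, pow_mul, Real.sq_sqrt Real.pi_pos.le]
  simp [h, h2]
  positivity

theorem integral_eq_integral_uniformSphere {f : EuclideanSpace ℝ (Fin 4) → ℂ}
    (hf : Integrable f) :
    ∫ x, f x = ∫ r in Set.Ioi (0 : ℝ),
      ((2 * Real.pi ^ 2 * r ^ 3 : ℝ) : ℂ) * ∫ x, f x ∂(uniformSphere 4 r) := by
  let E := EuclideanSpace ℝ (Fin 4)
  let μ : Measure E := volume
  have hmp := μ.measurePreserving_homeomorphUnitSphereProd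
  have hd : Module.finrank ℝ E - 1 = 3 := by simp [E]
  rw [hd] at hmp
  let g : Metric.sphere (0 : E) 1 × Set.Ioi (0 : ℝ) → ℂ := fun p => f (p.2.1 • p.1.1)
  have hgf : ∀ x : ({0}ᶜ : Set E), g (homeomorphUnitSphereProd E x) = f x := fun x => by
    simp only [g]
    congr 1
    exact congrArg Subtype.val ((homeomorphUnitSphereProd E).symm_apply_apply x)
  have hcomap : Integrable (fun x : ({0}ᶜ : Set E) => f x) (μ.comap (↑)) := by
    have := (integrableOn_iff_comap_subtypeVal (μ := μ) (f := f)
      (measurableSet_singleton (0 : E)).compl).1 hf.integrableOn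
    exact this
  have hg : Integrable g (μ.toSphere.prod (Measure.volumeIoiPow 3)) := by
    rw [← hmp.integrable_comp_emb (Homeomorph.measurableEmbedding _)]
    exact hcomap.congr (ae_of_all _ fun x => (hgf x).symm)
  have h1 : ∫ x, f x = ∫ p, g p ∂(μ.toSphere.prod (Measure.volumeIoiPow 3)) := by
    rw [← hmp.integral_comp (Homeomorph.measurableEmbedding _)]
    simp_rw [hgf]
    rw [integral_subtype_comap (measurableSet_singleton _).compl f, restrict_compl_singleton]
  rw [h1, integral_prod_symm _ hg]
  have h2 : ∀ r : Set.Ioi (0 : ℝ), ∫ u, g (u, r) ∂μ.toSphere =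
      ((2 * Real.pi ^ 2 : ℝ) : ℂ) * ∫ x, f x ∂(uniformSphere 4 r) := fun r => by
    have e : ∫ x, f x ∂(uniformSphere 4 r) = ∫ u, g (u, r) ∂(sphereLaw 4) := by
      rw [uniformSphere_eq_map]
      have hemb : MeasurableEmbedding fun u : Metric.sphere (0 : E) 1 => r.1 • (u : E) :=
        (Homeomorph.smulOfNeZero r.1 r.2.out.ne').measurableEmbedding.comp
          (MeasurableEmbedding.subtype_coe Metric.isClosed_sphere.measurableSet)
      exact hemb.integral_map f
    rw [e, sphereLaw, integral_smul_measure, Complex.real_smul, ← mul_assoc, ← Complex.ofReal_mul,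
      ENNReal.toReal_inv]
    -- The area of the unit sphere is the dimension times the volume of the ball, 4 · π²/2.
    have hu : (μ.toSphere Set.univ).toReal = 2 * Real.pi ^ 2 := by
      have := μ.toSphere_real_apply_univ
      rw [Measure.real] at this
      rw [this, volume_real_ball_four]
      simp [E]
      ring
    rw [hu, mul_inv_cancel₀ (by positivity), Complex.ofReal_one, one_mul]
  simp_rw [h2]
  simp only [Measure.volumeIoiPow, ENNReal.ofReal]
  rw [integral_withDensity_eq_integral_smul,
    integral_subtype_comap measurableSet_Ioi fun r : ℝ => Real.toNNReal (r ^ 3) •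
      (((2 * Real.pi ^ 2 : ℝ) : ℂ) * ∫ x, f x ∂(uniformSphere 4 r))]
  · refine setIntegral_congr_fun measurableSet_Ioi fun r hr => ?_
    simp only [NNReal.smul_def, Real.coe_toNNReal _ (pow_nonneg (Set.mem_Ioi.1 hr).le 3),
      Complex.real_smul]
    push_cast
    ring
  · exact (measurable_subtype_coe.pow_const _).real_toNNReal

theorem integral_uniformSphere_eq (m : ℕ) (r : ℝ) {F : Type*} [NormedAddCommGroup F]
    [NormedSpace ℝ F] {f : EuclideanSpace ℝ (Fin m) → F} (hf : StronglyMeasurable f) :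
    ∫ x, f x ∂(uniformSphere m r) = ∫ x, f (r • x) ∂(uniformSphere m 1) := by
  rw [uniformSphere_eq_map_smul, integral_map (by fun_prop) hf.aestronglyMeasurable]

/-- The Gaussian integral of ⟨x, ξ⟩^n is computed twice, in Cartesian and in polar coordinates. The
comparison determines the moments of the sphere; the Gamma factor is the radial integral. -/
theorem pi_sq_mul_integral_inner_pow_uniformSphere (ξ : EuclideanSpace ℝ (Fin 4)) (n : ℕ) :
    Real.pi ^ 2 * Real.Gamma ((n + 4) / 2) * ∫ x, inner ℝ x ξ ^ n ∂(uniformSphere 4 1) =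
      ‖ξ‖ ^ n * √Real.pi ^ 3 * ∫ x : ℝ, x ^ n * Real.exp (-x ^ 2) := by
  obtain ⟨hint, hval⟩ := integrable_inner_pow_mul_exp_and_integral ξ n
  rw [← hval]
  have hp := integral_eq_integral_uniformSphere
    (f := fun x => ((inner ℝ x ξ ^ n * Real.exp (-‖x‖ ^ 2) : ℝ) : ℂ)) hint.ofReal
  rw [integral_complex_ofReal] at hp
  have hr : ∀ r ∈ Set.Ioi (0 : ℝ), ((2 * Real.pi ^ 2 * r ^ 3 : ℝ) : ℂ) *
      ∫ x, ((inner ℝ x ξ ^ n * Real.exp (-‖x‖ ^ 2) : ℝ) : ℂ) ∂(uniformSphere 4 r) =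
      ((2 * Real.pi ^ 2 * (∫ x, inner ℝ x ξ ^ n ∂(uniformSphere 4 1)) *
        (r ^ (n + 3) * Real.exp (-r ^ 2)) : ℝ) : ℂ) := fun r hr => by
    rw [integral_complex_ofReal, ← Complex.ofReal_mul]
    congr 1
    have e : ∫ x, inner ℝ x ξ ^ n * Real.exp (-‖x‖ ^ 2) ∂(uniformSphere 4 r) =
        (r ^ n * Real.exp (-r ^ 2)) * ∫ x, inner ℝ x ξ ^ n ∂(uniformSphere 4 1) := by
      rw [← integral_const_mul]
      have e1 : ∫ x, inner ℝ x ξ ^ n * Real.exp (-‖x‖ ^ 2) ∂(uniformSphere 4 r) =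
          ∫ x, inner ℝ x ξ ^ n * Real.exp (-r ^ 2) ∂(uniformSphere 4 r) := by
        refine integral_congr_ae ?_
        filter_upwards [ae_norm_uniformSphere 4 (Set.mem_Ioi.1 hr).le] with x hx
        rw [hx]
      rw [e1, integral_uniformSphere_eq 4 r (by fun_prop)]
      congr 1
      ext x
      rw [inner_smul_left, mul_pow]
      simp
      ring
    rw [e]
    ring
  rw [setIntegral_congr_fun measurableSet_Ioi hr, integral_complex_ofReal,
    integral_const_mul, integral_Ioi_pow_mul_exp_neg_sq] at hp
  have hp' := Complex.ofReal_injective hp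
  rw [hp']
  push_cast
  rw [show (n : ℝ) + 3 + 1 = n + 4 by ring]
  ring

theorem integral_inner_pow_odd_uniformSphere (ξ : EuclideanSpace ℝ (Fin 4)) (k : ℕ) :
    ∫ x, inner ℝ x ξ ^ (2 * k + 1) ∂(uniformSphere 4 1) = 0 := by
  have h := pi_sq_mul_integral_inner_pow_uniformSphere ξ (2 * k + 1)
  rw [integral_pow_two_mul_add_one_mul_exp_neg_sq, mul_zero, mul_eq_zero] at h
  refine h.resolve_left (mul_ne_zero (by positivity) (Real.Gamma_pos_of_pos (by positivity)).ne')

theorem integral_inner_pow_even_uniformSphere (ξ : EuclideanSpace ℝ (Fin 4)) (k : ℕ) :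
    ∫ x, inner ℝ x ξ ^ (2 * k) ∂(uniformSphere 4 1) =
      (2 * k)! / (k ! * (k + 1)!) * (‖ξ‖ / 2) ^ (2 * k) := by
  have h := pi_sq_mul_integral_inner_pow_uniformSphere ξ (2 * k)
  rw [integral_pow_two_mul_mul_exp_neg_sq, Real.Gamma_nat_add_half_eq_factorial,
    show (((2 * k : ℕ) : ℝ) + 4) / 2 = ((k + 1 : ℕ) : ℝ) + 1 by push_cast; ring,
    Real.Gamma_nat_eq_factorial] at h
  have h4 : √Real.pi ^ 3 * √Real.pi = Real.pi ^ 2 := by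
    rw [← pow_succ, show 3 + 1 = 2 * 2 by rfl, pow_mul, Real.sq_sqrt Real.pi_pos.le]
  have hne : Real.pi ^ 2 * ((k + 1)! : ℝ) ≠ 0 := by positivity
  refine mul_left_cancel₀ hne (h.trans ?_)
  rw [div_pow, pow_mul 2 2 k, ← h4]
  field_simp
  norm_num

/-- The exponential is expanded and integrated termwise: odd moments vanish, and the even ones yield
(-z²)^k / (k! (k+1)!), which is a Catalan number over (2k)!. -/
theorem charFun_uniformSphere_one (ξ : EuclideanSpace ℝ (Fin 4)) :
    charFun (uniformSphere 4 1) ξ = (flightKernel (‖ξ‖ / 2) 0 1 : ℂ) := by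
  have hs : HasSum (fun n : ℕ => ∫ x, ((inner ℝ x ξ : ℂ) * Complex.I) ^ n / (n ! : ℂ)
      ∂(uniformSphere 4 1)) (charFun (uniformSphere 4 1) ξ) := by
    rw [charFun_apply]
    refine hasSum_integral_of_dominated_convergence (fun n _ => ‖ξ‖ ^ n / n !) (fun n => ?_)
      (fun n => ?_) ?_ (integrable_const _) ?_
    · exact Continuous.aestronglyMeasurable (by fun_prop)
    · filter_upwards [ae_norm_uniformSphere 4 zero_le_one] with x hx
      have h1 : |inner ℝ x ξ| ≤ ‖ξ‖ := by simpa [hx] using abs_real_inner_le_norm x ξ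
      simp only [norm_div, norm_pow, norm_mul, Complex.norm_I, mul_one, Complex.norm_real,
        Complex.norm_natCast, Real.norm_eq_abs]
      gcongr
    · exact ae_of_all _ fun _ => Real.summable_pow_div_factorial _
    · refine ae_of_all _ fun x => ?_
      rw [Complex.exp_eq_exp_ℂ]
      exact NormedSpace.expSeries_div_hasSum_exp _
  have hM : ∀ n : ℕ, ∫ x, ((inner ℝ x ξ : ℂ) * Complex.I) ^ n / (n ! : ℂ) ∂(uniformSphere 4 1) =
      Complex.I ^ n / n ! * ((∫ x, inner ℝ x ξ ^ n ∂(uniformSphere 4 1) : ℝ) : ℂ) := fun n => by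
    rw [← integral_complex_ofReal, ← integral_const_mul]
    congr 1
    ext x
    push_cast
    ring
  simp_rw [hM] at hs
  have hinj : Function.Injective fun k : ℕ => 2 * k := fun a b h => by simpa using h
  rw [← hinj.hasSum_iff] at hs
  · refine hs.unique ?_
    convert! Complex.hasSum_ofReal.2 (hasSum_flightKernel (‖ξ‖ / 2) 0 1) using 2 with k
    simp only [Function.comp_def, integral_inner_pow_even_uniformSphere, flightTerm,
      ballotCoeff_div_factorial]
    push_cast
    rw [pow_mul Complex.I, Complex.I_sq, neg_pow (((‖ξ‖ : ℂ) / 2) ^ 2) k, ← pow_mul]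
    have : ((2 * k)! : ℂ) ≠ 0 := by exact_mod_cast (2 * k).factorial_ne_zero
    rw [show 0 + 1 + k = k + 1 by ring]
    field_simp
    ring
  · intro n hn
    obtain ⟨k, rfl | rfl⟩ := n.even_or_odd'
    · exact absurd ⟨k, rfl⟩ hn
    · simp [integral_inner_pow_odd_uniformSphere]

theorem charFun_uniformSphere (ξ : EuclideanSpace ℝ (Fin 4)) {r : ℝ} (hr : 0 ≤ r) :
    charFun (uniformSphere 4 r) ξ = (flightKernel (‖ξ‖ / 2) 0 r : ℂ) := by
  rw [uniformSphere_eq_map_smul, charFun_map_smul, charFun_uniformSphere_one, norm_smul,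
    Real.norm_of_nonneg hr, mul_div_assoc]
  have := flightKernel_scale r (‖ξ‖ / 2) 0 1
  simp only [mul_one, pow_zero, one_mul] at this
  rw [this]

/-! ### The limit law and its Fourier transform -/

theorem measurable_stationaryACDensity (a ϱ : ℝ) : Measurable (stationaryACDensity a ϱ) := by
  unfold stationaryACDensity
  refine Measurable.ite (measurableSet_lt measurable_norm measurable_const) ?_ measurable_const
  fun_prop

theorem stationaryACDensity_nonneg {a : ℝ} (ha : 0 ≤ a) (ϱ : ℝ)
    (x : EuclideanSpace ℝ (Fin 4)) : 0 ≤ stationaryACDensity a ϱ x := by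
  unfold stationaryACDensity
  split_ifs with h
  · have h0 : 0 ≤ ‖x‖ := norm_nonneg x
    have h1 : ‖x‖ ^ 2 / ϱ ^ 2 ≤ 1 :=
      div_le_one_of_le₀ (pow_le_pow_left₀ h0 h.le 2) (sq_nonneg _)
    have : 0 ≤ a * (1 - ‖x‖ ^ 2 / ϱ ^ 2) := mul_nonneg ha (by linarith)
    positivity
  · exact le_rfl

theorem stationaryACDensity_le {a : ℝ} (ha : 0 ≤ a) (ϱ : ℝ) (x : EuclideanSpace ℝ (Fin 4)) :
    stationaryACDensity a ϱ x ≤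
      (Metric.ball 0 ϱ).indicator (fun _ => a / (Real.pi ^ 2 * ϱ ^ 4) * (2 + a)) x := by
  unfold stationaryACDensity
  by_cases h : ‖x‖ < ϱ
  · rw [if_pos h, Set.indicator_of_mem (by simpa using h)]
    have h1 : a * (1 - ‖x‖ ^ 2 / ϱ ^ 2) ≤ a :=
      mul_le_of_le_one_right ha (by linarith [show 0 ≤ ‖x‖ ^ 2 / ϱ ^ 2 by positivity])
    have h2 : Real.exp (-(a / ϱ ^ 2) * ‖x‖ ^ 2) ≤ 1 := by
      rw [Real.exp_le_one_iff, neg_mul]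
      exact neg_nonpos.2 (by positivity)
    refine (mul_le_of_le_one_right ?_ h2).trans ?_
    · have h3 : ‖x‖ ^ 2 / ϱ ^ 2 ≤ 1 :=
        div_le_one_of_le₀ (pow_le_pow_left₀ (norm_nonneg x) h.le 2) (sq_nonneg _)
      have : 0 ≤ a * (1 - ‖x‖ ^ 2 / ϱ ^ 2) := mul_nonneg ha (by linarith)
      positivity
    · gcongr
  · rw [if_neg h, Set.indicator_of_notMem (by simpa using h)]

theorem integrable_stationaryACDensity {a : ℝ} (ha : 0 ≤ a) (ϱ : ℝ) :
    Integrable (stationaryACDensity a ϱ) := by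
  have : Integrable ((Metric.ball (0 : EuclideanSpace ℝ (Fin 4)) ϱ).indicator
      fun _ => a / (Real.pi ^ 2 * ϱ ^ 4) * (2 + a)) :=
    (integrable_indicator_iff measurableSet_ball).2
      (integrableOn_const measure_ball_lt_top.ne)
  refine this.mono' (measurable_stationaryACDensity a ϱ).aestronglyMeasurable
    (ae_of_all _ fun x => ?_)
  rw [Real.norm_of_nonneg (stationaryACDensity_nonneg ha ϱ x)]
  exact stationaryACDensity_le ha ϱ x

theorem isFiniteMeasure_stationarySingularPart (a ϱ : ℝ) :
    IsFiniteMeasure (stationarySingularPart a ϱ) := by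
  exact Measure.smul_finite _ ENNReal.ofReal_ne_top

theorem isFiniteMeasure_withDensity_stationaryACDensity {a : ℝ} (ha : 0 ≤ a) (ϱ : ℝ) :
    IsFiniteMeasure ((volume : Measure (EuclideanSpace ℝ (Fin 4))).withDensity
      fun x => ENNReal.ofReal (stationaryACDensity a ϱ x)) :=
  isFiniteMeasure_withDensity_ofReal (integrable_stationaryACDensity ha ϱ).2

theorem isFiniteMeasure_stationaryLaw {a : ℝ} (ha : 0 ≤ a) (ϱ : ℝ) :
    IsFiniteMeasure (stationaryLaw a ϱ) := by
  have := isFiniteMeasure_stationarySingularPart a ϱ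
  have := isFiniteMeasure_withDensity_stationaryACDensity ha ϱ
  unfold stationaryLaw
  infer_instance

theorem integral_stationarySingularPart (a ϱ : ℝ) {F : Type*} [NormedAddCommGroup F]
    [NormedSpace ℝ F] (f : EuclideanSpace ℝ (Fin 4) → F) :
    ∫ x, f x ∂(stationarySingularPart a ϱ) =
      Real.exp (-a) • ∫ x, f x ∂(uniformSphere 4 ϱ) := by
  rw [stationarySingularPart, integral_smul_measure,
    ENNReal.toReal_ofReal (Real.exp_pos _).le]

theorem integral_stationaryLaw {a : ℝ} (ha : 0 ≤ a) (ϱ : ℝ) {F : Type*} [NormedAddCommGroup F]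
    [NormedSpace ℝ F] {f : EuclideanSpace ℝ (Fin 4) → F} {C : ℝ} (hf : StronglyMeasurable f)
    (hC : ∀ x, ‖f x‖ ≤ C) :
    ∫ x, f x ∂(stationaryLaw a ϱ) = ∫ x, f x ∂(stationarySingularPart a ϱ) +
      ∫ x, stationaryACDensity a ϱ x • f x := by
  have := isFiniteMeasure_stationarySingularPart a ϱ
  have := isFiniteMeasure_withDensity_stationaryACDensity ha ϱ
  rw [stationaryLaw, integral_add_measure
    (Integrable.of_bound hf.aestronglyMeasurable C (ae_of_all _ hC))
    (Integrable.of_bound hf.aestronglyMeasurable C (ae_of_all _ hC)),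
    integral_withDensity_eq_integral_toReal_smul
      (measurable_stationaryACDensity a ϱ).ennreal_ofReal (ae_of_all _ fun _ => by simp)]
  simp_rw [ENNReal.toReal_ofReal (stationaryACDensity_nonneg ha ϱ _)]

theorem hasSum_add_two_mul_pow_div_factorial (x : ℝ) :
    HasSum (fun n : ℕ => (n + 2) * (x ^ n / n !)) ((2 + x) * Real.exp x) := by
  have h := Real.hasSum_pow_div_factorial x
  have h1 : HasSum (fun n : ℕ => n * (x ^ n / n !)) (x * Real.exp x) := by
    rw [← hasSum_nat_add_iff' 1]
    simp only [Finset.sum_range_one, Nat.cast_zero, zero_mul, sub_zero]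
    convert! h.mul_left x using 2 with n
    rw [Nat.factorial_succ, pow_succ]
    push_cast
    field_simp
  convert! h1.add (h.mul_left 2) using 1
  · ext n; ring
  · ring

theorem integral_pow_mul_sq_sub_sq_pow (ϱ : ℝ) (p q : ℕ) :
    ∫ r in (0 : ℝ)..ϱ, r ^ (2 * p + 1) * (ϱ ^ 2 - r ^ 2) ^ q =
      p ! * q ! * ϱ ^ (2 * (p + q + 1)) / (2 * (p + q + 1)!) := by
  have h := intervalIntegral.integral_comp_mul_deriv (a := 0) (b := ϱ) (f := fun r : ℝ => r ^ 2)
    (f' := fun r => 2 * r) (g := fun v => v ^ p * (ϱ ^ 2 - v) ^ q)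
    (fun x _ => by simpa using hasDerivAt_pow 2 x) (by fun_prop) (by fun_prop)
  have e : ∀ r : ℝ, r ^ (2 * p + 1) * (ϱ ^ 2 - r ^ 2) ^ q =
      (1 / 2) * (((fun v => v ^ p * (ϱ ^ 2 - v) ^ q) ∘ fun r : ℝ => r ^ 2) r * (2 * r)) := fun r => by
    simp only [Function.comp_def]
    rw [← pow_mul]
    ring
  simp_rw [e]
  rw [intervalIntegral.integral_const_mul, h]
  simp only [ne_eq, OfNat.ofNat_ne_zero, not_false_eq_true, zero_pow]
  rw [integral_pow_mul_sub_pow, ← pow_mul]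
  field_simp

/-- The factor exp(-a r²/ϱ²) is e^{-a} e^y with y = a(1 - r²/ϱ²), and (2 + y)e^y is expanded in
powers of y. The beta integral of r^{2k+3}(ϱ² - r²)^n cancels the (k+1)! of the sphere transform and
leaves (n+2) / (k! (n+2+k)!), the ballot coefficient for n+1 switches. -/
theorem hasSum_integral_radial {a ϱ : ℝ} (ha : 0 < a) (hϱ : 0 < ϱ) (z : ℝ) :
    HasSum (fun n : ℕ => Real.exp (-a) * (a / ϱ) ^ (n + 1) * flightKernel z (n + 1) ϱ)
      (∫ r in (0 : ℝ)..ϱ, 2 * Real.pi ^ 2 * r ^ 3 *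
        (a / (Real.pi ^ 2 * ϱ ^ 4) * (2 + a * (1 - r ^ 2 / ϱ ^ 2)) *
          Real.exp (-(a / ϱ ^ 2) * r ^ 2)) * flightKernel z 0 r) := by
  obtain ⟨A, hA, hA0, hAb⟩ := exists_summable_flightTerm_le z ϱ 0 hϱ.le
  -- This is the product of the area constant 2π², the prefactor a/(π²ϱ⁴) and e^{-a}.
  let C : ℝ := 2 * a * Real.exp (-a) / ϱ ^ 4
  have hC : 0 ≤ C := by positivity
  have hE := hasSum_add_two_mul_pow_div_factorial a
  have hsum : Summable fun p : ℕ × ℕ =>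
      C * ϱ ^ 3 * (((p.1 + 2) * (a ^ p.1 / (p.1)!)) * A p.2) :=
    (hE.summable.mul_of_nonneg hA (fun n => by positivity) hA0).mul_left _
  let f : ℕ × ℕ → ℝ → ℝ := fun p r => C * r ^ 3 *
    (((p.1 + 2) * ((a * (1 - r ^ 2 / ϱ ^ 2)) ^ p.1 / (p.1)!)) * flightTerm z 0 p.2 r)
  have hb : ∀ p : ℕ × ℕ, ∀ r ∈ Set.Icc 0 ϱ, |f p r| ≤
      C * ϱ ^ 3 * (((p.1 + 2) * (a ^ p.1 / (p.1)!)) * A p.2) := fun p r hr => by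
    have hr2 : r ^ 2 / ϱ ^ 2 ≤ 1 :=
      div_le_one_of_le₀ (pow_le_pow_left₀ hr.1 hr.2 2) (sq_nonneg _)
    have hr3 : 0 ≤ r ^ 2 / ϱ ^ 2 := by positivity
    have hy0 : 0 ≤ a * (1 - r ^ 2 / ϱ ^ 2) := mul_nonneg ha.le (by linarith)
    have hy1 : a * (1 - r ^ 2 / ϱ ^ 2) ≤ a := mul_le_of_le_one_right ha.le (by linarith)
    have hr0 := hr.1
    simp only [f]
    rw [abs_mul, abs_of_nonneg (by positivity : 0 ≤ C * r ^ 3), abs_mul,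
      abs_of_nonneg (by positivity :
        0 ≤ ((p.1 : ℝ) + 2) * ((a * (1 - r ^ 2 / ϱ ^ 2)) ^ p.1 / (p.1)!))]
    have hk := hAb p.2 r (abs_le.2 ⟨by linarith, hr.2⟩)
    have := hr.2
    gcongr
  have hs : ∀ r ∈ Set.Icc 0 ϱ, HasSum (fun p => f p r) (2 * Real.pi ^ 2 * r ^ 3 *
        (a / (Real.pi ^ 2 * ϱ ^ 4) * (2 + a * (1 - r ^ 2 / ϱ ^ 2)) *
          Real.exp (-(a / ϱ ^ 2) * r ^ 2)) * flightKernel z 0 r) := fun r hr => by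
    have h1 := (hasSum_add_two_mul_pow_div_factorial (a * (1 - r ^ 2 / ϱ ^ 2))).mul_left (C * r ^ 3)
    have h2 := hasSum_flightKernel z 0 r
    have h3 := h1.mul h2 (by
      refine Summable.of_norm_bounded hsum fun p => ?_
      have := hb p r hr
      simp only [f] at this
      rw [← mul_assoc] at this
      exact this)
    convert! h3 using 1
    · ext p; simp only [f]; ring
    · have : Real.exp (-(a / ϱ ^ 2) * r ^ 2) =
          Real.exp (-a) * Real.exp (a * (1 - r ^ 2 / ϱ ^ 2)) := by
        rw [← Real.exp_add]; congr 1; field_simp; ring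
      rw [this]
      simp only [C]
      field_simp
  have h := hasSum_intervalIntegral_of_bound hϱ.le (f := f)
    (fun p => by have := continuous_flightTerm z 0 p.2; fun_prop) hsum hb hs
  have hI : ∀ p : ℕ × ℕ, ∫ r in (0 : ℝ)..ϱ, f p r =
      Real.exp (-a) * (a / ϱ) ^ (p.1 + 1) * flightTerm z (p.1 + 1) p.2 ϱ := fun p => by
    obtain ⟨n, k⟩ := p
    have e : ∀ r, f (n, k) r = C * (n + 2) * a ^ n / (n ! * ϱ ^ (2 * n)) * (-z ^ 2) ^ k *
        (ballotCoeff (0 + 1) k / (0 + 2 * k)!) *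
        (r ^ (2 * (k + 1) + 1) * (ϱ ^ 2 - r ^ 2) ^ n) := fun r => by
      simp only [f, flightTerm]
      have : 1 - r ^ 2 / ϱ ^ 2 = (ϱ ^ 2 - r ^ 2) / ϱ ^ 2 := by field_simp
      rw [this, mul_pow, div_pow, ← pow_mul ϱ]
      field_simp
      ring
    simp_rw [e]
    rw [intervalIntegral.integral_const_mul, integral_pow_mul_sq_sub_sq_pow]
    simp only [flightTerm, ballotCoeff_div_factorial, C]
    rw [show k + 1 + n + 1 = n + 1 + 1 + k by ring, show 0 + 1 + k = k + 1 by ring, div_pow]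
    push_cast
    field_simp
    ring
  simp_rw [hI] at h
  -- For fixed n, summation over k reassembles the kernel.
  exact h.prod_fiberwise fun n => (hasSum_flightKernel z (n + 1) ϱ).mul_left _

theorem norm_cexp_inner_mul_I {m : ℕ} (x ξ : EuclideanSpace ℝ (Fin m)) :
    ‖Complex.exp ((inner ℝ x ξ : ℝ) * Complex.I)‖ = 1 := Complex.norm_exp_ofReal_mul_I _

theorem integral_stationaryACDensity_mul_cexp {a ϱ : ℝ} (ha : 0 ≤ a) (hϱ : 0 ≤ ϱ)
    (ξ : EuclideanSpace ℝ (Fin 4)) :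
    ∫ x, stationaryACDensity a ϱ x • Complex.exp ((inner ℝ x ξ : ℝ) * Complex.I) =
      ((∫ r in (0 : ℝ)..ϱ, 2 * Real.pi ^ 2 * r ^ 3 *
        (a / (Real.pi ^ 2 * ϱ ^ 4) * (2 + a * (1 - r ^ 2 / ϱ ^ 2)) *
          Real.exp (-(a / ϱ ^ 2) * r ^ 2)) * flightKernel (‖ξ‖ / 2) 0 r : ℝ) : ℂ) := by
  have hint : Integrable fun x : EuclideanSpace ℝ (Fin 4) =>
      stationaryACDensity a ϱ x • Complex.exp ((inner ℝ x ξ : ℝ) * Complex.I) := by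
    refine (integrable_stationaryACDensity ha ϱ).mono
      ((measurable_stationaryACDensity a ϱ).smul (by fun_prop)).aestronglyMeasurable
      (ae_of_all _ fun x => ?_)
    rw [norm_smul, norm_cexp_inner_mul_I, mul_one]
  rw [integral_eq_integral_uniformSphere hint]
  let G : ℝ → ℝ := fun r => 2 * Real.pi ^ 2 * r ^ 3 *
        (a / (Real.pi ^ 2 * ϱ ^ 4) * (2 + a * (1 - r ^ 2 / ϱ ^ 2)) *
          Real.exp (-(a / ϱ ^ 2) * r ^ 2)) * flightKernel (‖ξ‖ / 2) 0 r
  have h : ∀ r ∈ Set.Ioi (0 : ℝ), ((2 * Real.pi ^ 2 * r ^ 3 : ℝ) : ℂ) *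
      ∫ x, stationaryACDensity a ϱ x • Complex.exp ((inner ℝ x ξ : ℝ) * Complex.I)
        ∂(uniformSphere 4 r) = (((Set.Iio ϱ).indicator G r : ℝ) : ℂ) := fun r hr => by
    have hr0 : 0 ≤ r := (Set.mem_Ioi.1 hr).le
    have e : ∫ x, stationaryACDensity a ϱ x • Complex.exp ((inner ℝ x ξ : ℝ) * Complex.I)
        ∂(uniformSphere 4 r) = ∫ x, (if r < ϱ then a / (Real.pi ^ 2 * ϱ ^ 4) *
          (2 + a * (1 - r ^ 2 / ϱ ^ 2)) * Real.exp (-(a / ϱ ^ 2) * r ^ 2) else 0) •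
            Complex.exp ((inner ℝ x ξ : ℝ) * Complex.I) ∂(uniformSphere 4 r) := by
      refine integral_congr_ae ?_
      filter_upwards [ae_norm_uniformSphere 4 hr0] with x hx
      rw [stationaryACDensity, hx]
    rw [e, integral_smul, ← charFun_apply, charFun_uniformSphere ξ hr0]
    by_cases hrϱ : r < ϱ
    · rw [if_pos hrϱ, Set.indicator_of_mem (by exact hrϱ), Complex.real_smul]
      simp only [G]
      push_cast
      ring
    · rw [if_neg hrϱ, Set.indicator_of_notMem (by exact hrϱ)]
      simp
  rw [setIntegral_congr_fun measurableSet_Ioi h, integral_complex_ofReal,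
    setIntegral_indicator measurableSet_Iio, intervalIntegral.integral_of_le hϱ,
    Set.Ioi_inter_Iio, integral_Ioc_eq_integral_Ioo]

theorem hasSum_charFun_stationaryLaw {a ϱ : ℝ} (ha : 0 < a) (hϱ : 0 < ϱ)
    (ξ : EuclideanSpace ℝ (Fin 4)) :
    HasSum (fun n : ℕ => ((Real.exp (-a) * (a / ϱ) ^ n * flightKernel (‖ξ‖ / 2) n ϱ : ℝ) : ℂ))
      (charFun (stationaryLaw a ϱ) ξ) := by
  rw [charFun_apply, integral_stationaryLaw ha.le ϱ
    (Continuous.stronglyMeasurable (by fun_prop)) (fun x => (norm_cexp_inner_mul_I x ξ).le),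
    integral_stationaryACDensity_mul_cexp ha.le hϱ.le,
    integral_stationarySingularPart, ← charFun_apply, charFun_uniformSphere ξ hϱ.le,
    Complex.real_smul, ← Complex.ofReal_mul, ← Complex.ofReal_add, Complex.hasSum_ofReal,
    -- The term n = 0 is the transform of the singular part; the shifted series is that of the
    -- density.
    ← hasSum_nat_add_iff' 1]
  simpa using hasSum_integral_radial ha hϱ (‖ξ‖ / 2)

theorem isProbabilityMeasure_stationaryLaw {a ϱ : ℝ} (ha : 0 < a) (hϱ : 0 < ϱ) :
    IsProbabilityMeasure (stationaryLaw a ϱ) := by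
  have := isFiniteMeasure_stationaryLaw ha.le ϱ
  -- At frequency zero the series is that of the Poisson weights e^{-a} a^n/n!, so the total mass is
  -- one.
  have h := hasSum_charFun_stationaryLaw ha hϱ 0
  rw [charFun_zero, Complex.hasSum_ofReal] at h
  simp only [norm_zero, zero_div, flightKernel_zero] at h
  have h2 := (Real.hasSum_pow_div_factorial a).mul_left (Real.exp (-a))
  rw [← Real.exp_add, neg_add_cancel, Real.exp_zero] at h2
  have h3 : (stationaryLaw a ϱ).real Set.univ = 1 := by
    refine h.unique ?_
    convert! h2 using 2 with n
    rw [div_pow]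
    field_simp
  constructor
  rw [← ENNReal.toReal_eq_one_iff]
  exact h3

end

/-! ### Integration over a single leg, and its independence from the past -/

theorem integral_expMeasure {r : ℝ} (hr : 0 < r) {F : Type*} [NormedAddCommGroup F]
    [NormedSpace ℝ F] (g : ℝ → F) :
    ∫ w, g w ∂(expMeasure r) = ∫ w in Set.Ioi 0, (r * Real.exp (-(r * w))) • g w := by
  have h : expMeasure r = volume.withDensity (exponentialPDF r) := rfl
  have hm : Measurable (exponentialPDF r) := (measurable_exponentialPDFReal r).ennreal_ofReal
  rw [h, integral_withDensity_eq_integral_toReal_smul hm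
    (ae_of_all _ fun _ => ENNReal.ofReal_lt_top), ← integral_indicator measurableSet_Ioi]
  refine integral_congr_ae ?_
  have h0 : ∀ᵐ x : ℝ, x ≠ 0 := by simp [ae_iff]
  filter_upwards [h0] with x hx
  rcases lt_or_gt_of_ne hx with hx | hx
  · rw [exponentialPDF_of_neg hx, Set.indicator_of_notMem (by simpa using hx.le)]
    simp
  · rw [exponentialPDF_of_nonneg hx.le, Set.indicator_of_mem (by simpa using hx),
      ENNReal.toReal_ofReal (by positivity)]

theorem ae_nonneg_expMeasure (r : ℝ) : ∀ᵐ w ∂(expMeasure r), 0 ≤ w := by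
  have h : expMeasure r = volume.withDensity (exponentialPDF r) := rfl
  have hm : Measurable (exponentialPDF r) := (measurable_exponentialPDFReal r).ennreal_ofReal
  rw [h, ae_withDensity_iff hm]
  refine ae_of_all _ fun x hx => ?_
  by_contra hlt
  exact hx (exponentialPDF_of_neg (not_le.1 hlt))

/-- The direction is integrated first, which produces the sphere transform. A completed leg has ψ w
= c w; the leg in progress at time t has constant ψ. -/
theorem integral_cexp_expMeasure_prod {r : ℝ} (hr : 0 < r) (ξ : EuclideanSpace ℝ (Fin 4))
    {g ψ : ℝ → ℝ} {C : ℝ} (hg : Measurable g) (hψ : Measurable ψ) (hC : ∀ w, |g w| ≤ C)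
    (hψ0 : ∀ w, 0 < w → 0 ≤ ψ w) :
    ∫ q, (g q.1 : ℂ) * Complex.exp ((inner ℝ (ψ q.1 • q.2) ξ : ℝ) * Complex.I)
        ∂((expMeasure r).prod (uniformSphere 4 1)) =
      ((∫ w in Set.Ioi 0, r * Real.exp (-(r * w)) *
        (g w * flightKernel (‖ξ‖ / 2) 0 (ψ w)) : ℝ) : ℂ) := by
  have := isProbabilityMeasure_expMeasure hr
  have hint : Integrable (fun q : ℝ × EuclideanSpace ℝ (Fin 4) =>
      (g q.1 : ℂ) * Complex.exp ((inner ℝ (ψ q.1 • q.2) ξ : ℝ) * Complex.I))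
      ((expMeasure r).prod (uniformSphere 4 1)) := by
    refine Integrable.of_bound (C := C) (Measurable.aestronglyMeasurable (by fun_prop))
      (ae_of_all _ fun q => ?_)
    rw [norm_mul, Complex.norm_exp_ofReal_mul_I, mul_one, Complex.norm_real]
    exact hC _
  rw [integral_prod _ hint, integral_expMeasure hr, ← integral_complex_ofReal]
  refine setIntegral_congr_fun measurableSet_Ioi fun w hw => ?_
  simp only
  rw [integral_const_mul]
  have e : ∫ x, Complex.exp ((inner ℝ (ψ w • x) ξ : ℝ) * Complex.I) ∂(uniformSphere 4 1) =
      (flightKernel (‖ξ‖ / 2) 0 (ψ w) : ℂ) := by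
    rw [← charFun_uniformSphere ξ (hψ0 w hw), charFun_apply,
      integral_uniformSphere_eq 4 (ψ w) (Continuous.stronglyMeasurable (by fun_prop))]
  rw [e, Complex.real_smul]
  push_cast
  ring

namespace RandomFlight

variable {Ω : Type*} [MeasurableSpace Ω] {P : Measure Ω} {m : ℕ} {lam : ℝ}

/-- The position at the time of the `n`-th Poisson event. -/
noncomputable def turningPoint (F : RandomFlight P m lam) (c : ℝ) (n : ℕ) (ω : Ω) :
    EuclideanSpace ℝ (Fin m) :=
  ∑ k ∈ Finset.range n, (c * F.wait k ω) • F.dir k ω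

theorem measurable_arrival (F : RandomFlight P m lam) (n : ℕ) : Measurable (F.arrival n) := by
  unfold arrival
  exact Finset.measurable_fun_sum _ fun k _ => F.measurable_wait k

theorem measurable_turningPoint (F : RandomFlight P m lam) (c : ℝ) (n : ℕ) :
    Measurable (F.turningPoint c n) := by
  unfold turningPoint
  exact Finset.measurable_fun_sum _ fun k _ =>
    ((F.measurable_wait k).const_mul c).smul (F.measurable_dir k)

theorem indepFun_turningPoint_arrival (F : RandomFlight P m lam) (c : ℝ) (n : ℕ) :
    IndepFun (fun ω => (F.turningPoint c n ω, F.arrival n ω))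
      (fun ω => (F.wait n ω, F.dir n ω)) P := by
  have h := F.indep.indepFun_finset (Finset.range n) {n} (by simp)
    fun k => (F.measurable_wait k).prodMk (F.measurable_dir k)
  let φ : (Finset.range n → ℝ × EuclideanSpace ℝ (Fin m)) → EuclideanSpace ℝ (Fin m) × ℝ :=
    fun v => (∑ k, (c * (v k).1) • (v k).2, ∑ k, (v k).1)
  let ψ : (({n} : Finset ℕ) → ℝ × EuclideanSpace ℝ (Fin m)) → ℝ × EuclideanSpace ℝ (Fin m) :=
    fun v => v ⟨n, Finset.mem_singleton_self n⟩
  have hφ : Measurable φ := by fun_prop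
  have hψ : Measurable ψ := measurable_pi_apply _
  have h2 := h.comp hφ hψ
  convert! h2 using 1
  ext ω : 1
  simp only [φ, Function.comp_def, turningPoint, arrival]
  rw [Finset.sum_coe_sort (Finset.range n) fun k => (c * F.wait k ω) • F.dir k ω,
    Finset.sum_coe_sort (Finset.range n) fun k => F.wait k ω]

theorem integral_comp_turningPoint [IsProbabilityMeasure P] (F : RandomFlight P m lam)
    (hlam : 0 < lam) [NeZero m] (c : ℝ) (n : ℕ)
    {Φ : (EuclideanSpace ℝ (Fin m) × ℝ) × (ℝ × EuclideanSpace ℝ (Fin m)) → ℂ} {C : ℝ}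
    (hΦ : Measurable Φ) (hC : ∀ x, ‖Φ x‖ ≤ C) :
    ∫ ω, Φ ((F.turningPoint c n ω, F.arrival n ω), (F.wait n ω, F.dir n ω)) ∂P =
      ∫ ω, ∫ q, Φ ((F.turningPoint c n ω, F.arrival n ω), q)
        ∂((expMeasure lam).prod (uniformSphere m 1)) ∂P := by
  have := isProbabilityMeasure_expMeasure hlam
  have hY : Measurable fun ω => (F.turningPoint c n ω, F.arrival n ω) :=
    (F.measurable_turningPoint c n).prodMk (F.measurable_arrival n)
  have hZ : Measurable fun ω => (F.wait n ω, F.dir n ω) :=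
    (F.measurable_wait n).prodMk (F.measurable_dir n)
  have := Measure.isProbabilityMeasure_map (μ := P) hY.aemeasurable
  have hlaw := (indepFun_iff_map_prod_eq_prod_map_map hY.aemeasurable hZ.aemeasurable).1
    (F.indepFun_turningPoint_arrival c n)
  rw [F.law_pair] at hlaw
  have h1 := integral_map (hY.prodMk hZ).aemeasurable (μ := P) hΦ.aestronglyMeasurable
  rw [← h1, hlaw, integral_prod _ (Integrable.of_bound (C := C) hΦ.aestronglyMeasurable
    (ae_of_all _ hC)), integral_map hY.aemeasurable]
  exact (hΦ.stronglyMeasurable.integral_prod_right').aestronglyMeasurable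

end RandomFlight

/-- The transform, at the frequency encoded by `z`, of the displacement over the remaining time
`t - s`, restricted to `n` changes of direction in that time. -/
noncomputable def remainingTransform (lam z t : ℝ) (n : ℕ) (s : ℝ) : ℝ :=
  if s ≤ t then lam ^ n * Real.exp (-(lam * (t - s))) * flightKernel z n (t - s) else 0

theorem measurable_remainingTransform (lam z t : ℝ) (n : ℕ) :
    Measurable (remainingTransform lam z t n) := by
  have := (continuous_flightKernel z n).measurable
  unfold remainingTransform
  exact Measurable.ite measurableSet_Iic (by fun_prop) measurable_const

theorem exists_abs_remainingTransform_le {lam : ℝ} (hlam : 0 < lam) (z t : ℝ) (n : ℕ) :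
    ∃ C, ∀ s, 0 ≤ s → |remainingTransform lam z t n s| ≤ C := by
  refine ⟨lam ^ n * (|t| ^ n / n.factorial * Real.exp (z ^ 2 * |t| ^ 2)), fun s hs => ?_⟩
  unfold remainingTransform
  split_ifs with h
  · have h1 : Real.exp (-(lam * (t - s))) ≤ 1 :=
      Real.exp_le_one_iff.2 (neg_nonpos.2 (mul_nonneg hlam.le (by linarith)))
    have h2 : |t - s| ≤ |t| := by
      rw [abs_of_nonneg (by linarith)]; linarith [le_abs_self t]
    rw [abs_mul, abs_of_nonneg (by positivity : 0 ≤ lam ^ n * Real.exp (-(lam * (t - s))))]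
    exact mul_le_mul (mul_le_of_le_one_right (by positivity) h1) (abs_flightKernel_le h2 n)
      (abs_nonneg _) (by positivity)
  · rw [abs_zero]; positivity

/-- This is the renewal equation for the next leg: the exponential factors multiply to e^{-λ(t-s)}
whatever w is, so only the convolution of kernels over 0 < w ≤ t - s remains. Both sides vanish for
s > t. -/
theorem integral_remainingTransform (lam z t : ℝ) (n : ℕ) (s : ℝ) :
    ∫ w in Set.Ioi 0, lam * Real.exp (-(lam * w)) *
      (remainingTransform lam z t n (s + w) * flightKernel z 0 w) =
      remainingTransform lam z t (n + 1) s := by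
  have e : ∀ w, lam * Real.exp (-(lam * w)) *
      (remainingTransform lam z t n (s + w) * flightKernel z 0 w) =
      (Set.Iic (t - s)).indicator (fun w => lam ^ (n + 1) * Real.exp (-(lam * (t - s))) *
        (flightKernel z 0 w * flightKernel z n (t - s - w))) w := fun w => by
    unfold remainingTransform
    by_cases h : s + w ≤ t
    · rw [if_pos h, Set.indicator_of_mem (by rw [Set.mem_Iic]; linarith)]
      have : Real.exp (-(lam * (t - s))) =
          Real.exp (-(lam * w)) * Real.exp (-(lam * (t - (s + w)))) := by
        rw [← Real.exp_add]; congr 1; ring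
      rw [this, sub_add_eq_sub_sub]
      ring
    · rw [if_neg h, Set.indicator_of_notMem (by rw [Set.mem_Iic]; linarith)]
      ring
  simp_rw [e]
  rw [setIntegral_indicator measurableSet_Iic, Set.Ioi_inter_Iic]
  by_cases h : s ≤ t
  · rw [← intervalIntegral.integral_of_le (by linarith), intervalIntegral.integral_const_mul,
      integral_flightKernel_mul z n (by linarith), remainingTransform, if_pos h]
  · rw [Set.Ioc_eq_empty (by linarith), remainingTransform, if_neg h]
    simp

theorem integral_exp_Ioi_sub {lam : ℝ} (hlam : 0 < lam) {u : ℝ} (hu : 0 ≤ u) :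
    ∫ w in Set.Ioi 0, lam * Real.exp (-(lam * w)) * (Set.Ioi u).indicator 1 w =
      Real.exp (-(lam * u)) := by
  have e : ∀ w, lam * Real.exp (-(lam * w)) * (Set.Ioi u).indicator 1 w =
      (Set.Ioi u).indicator (fun w => lam * Real.exp (-lam * w)) w := fun w => by
    by_cases h : w ∈ Set.Ioi u <;> simp [h]
  simp_rw [e]
  rw [setIntegral_indicator measurableSet_Ioi, Set.Ioi_inter_Ioi, sup_of_le_right hu,
    integral_const_mul, integral_exp_mul_Ioi (by linarith)]
  field_simp

/-! ### The transform of the position for a given number of switches -/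

namespace RandomFlight

variable {Ω : Type*} [MeasurableSpace Ω] {P : Measure Ω} {lam : ℝ}

/-- Exactly `n` Poisson events happen up to time `t`. -/
def countEvent (F : RandomFlight P 4 lam) (t : ℝ) (n : ℕ) : Set Ω :=
  {ω | F.arrival n ω ≤ t ∧ t < F.arrival n ω + F.wait n ω}

theorem measurableSet_countEvent (F : RandomFlight P 4 lam) (t : ℝ) (n : ℕ) :
    MeasurableSet (F.countEvent t n) :=
  (measurableSet_le (F.measurable_arrival n) measurable_const).inter
    (measurableSet_lt measurable_const ((F.measurable_arrival n).add (F.measurable_wait n)))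

theorem ae_wait_nonneg (F : RandomFlight P 4 lam) (hlam : 0 < lam) :
    ∀ᵐ ω ∂P, ∀ k, 0 ≤ F.wait k ω := by
  have := isProbabilityMeasure_expMeasure hlam
  rw [ae_all_iff]
  intro k
  have hZ : Measurable fun ω => (F.wait k ω, F.dir k ω) :=
    (F.measurable_wait k).prodMk (F.measurable_dir k)
  have h : P.map (F.wait k) = expMeasure lam := by
    have h1 := congrArg (Measure.map Prod.fst) (F.law_pair k)
    rw [Measure.map_map measurable_fst hZ, Measure.map_fst_prod] at h1
    simpa [Function.comp_def] using h1
  have h2 := ae_nonneg_expMeasure lam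
  rw [← h] at h2
  exact ae_of_ae_map (F.measurable_wait k).aemeasurable h2

theorem arrival_succ (F : RandomFlight P 4 lam) (n : ℕ) (ω : Ω) :
    F.arrival (n + 1) ω = F.arrival n ω + F.wait n ω := Finset.sum_range_succ _ _

theorem monotone_arrival (F : RandomFlight P 4 lam) {ω : Ω} (h : ∀ k, 0 ≤ F.wait k ω) :
    Monotone fun n => F.arrival n ω :=
  monotone_nat_of_le_succ fun n => by rw [arrival_succ]; linarith [h n]

/-- Averaging over the last completed leg, which is independent of the earlier ones, trades it for
one more switch in the remaining time, by the renewal equation. -/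
theorem integral_turningPoint_succ [IsProbabilityMeasure P] (F : RandomFlight P 4 lam) (hlam : 0 < lam) {c : ℝ}
    (hc : 0 < c) (t : ℝ) (ξ : EuclideanSpace ℝ (Fin 4)) (m n : ℕ) :
    ∫ ω, Complex.exp ((inner ℝ (F.turningPoint c (n + 1) ω) ξ : ℝ) * Complex.I) *
        (remainingTransform lam (c * (‖ξ‖ / 2)) t m (F.arrival (n + 1) ω) : ℂ) ∂P =
      ∫ ω, Complex.exp ((inner ℝ (F.turningPoint c n ω) ξ : ℝ) * Complex.I) *
        (remainingTransform lam (c * (‖ξ‖ / 2)) t (m + 1) (F.arrival n ω) : ℂ) ∂P := by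
  let z := c * (‖ξ‖ / 2)
  obtain ⟨C, hC⟩ := exists_abs_remainingTransform_le hlam z t m
  -- The uniform bound is available only for s ≥ 0; arrival times are almost surely nonnegative, so
  -- the truncation costs nothing.
  let V : ℝ → ℝ := fun s => if 0 ≤ s then remainingTransform lam z t m s else 0
  have hV : Measurable V :=
    (measurable_remainingTransform lam z t m).ite measurableSet_Ici measurable_const
  have hVC : ∀ s, |V s| ≤ max C 0 := fun s => by
    simp only [V]
    split_ifs with h
    · exact (hC s h).trans (le_max_left _ _)
    · simp
  have hpos := F.ae_wait_nonneg hlam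
  have h1 := F.integral_comp_turningPoint hlam c n
    (Φ := fun x => Complex.exp ((inner ℝ (x.1.1 + (c * x.2.1) • x.2.2) ξ : ℝ) * Complex.I) *
      (V (x.1.2 + x.2.1) : ℂ)) (C := max C 0) (by fun_prop) (fun x => by
        rw [norm_mul, Complex.norm_exp_ofReal_mul_I, one_mul, Complex.norm_real]
        exact hVC _)
  refine Eq.trans (integral_congr_ae ?_) (h1.trans (integral_congr_ae ?_))
  · filter_upwards [hpos] with ω hω
    have h0 : 0 ≤ F.arrival (n + 1) ω := by
      have := F.monotone_arrival hω (Nat.zero_le (n + 1))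
      simpa [arrival] using this
    simp only [V]
    rw [← arrival_succ, if_pos h0]
    simp only [turningPoint, Finset.sum_range_succ, z]
  · filter_upwards [hpos] with ω hω
    have h0 : 0 ≤ F.arrival n ω := by
      have := F.monotone_arrival hω (Nat.zero_le n)
      simpa [arrival] using this
    have e : ∀ q : ℝ × EuclideanSpace ℝ (Fin 4),
        Complex.exp ((inner ℝ (F.turningPoint c n ω + (c * q.1) • q.2) ξ : ℝ) * Complex.I) *
          (V (F.arrival n ω + q.1) : ℂ) =
        Complex.exp ((inner ℝ (F.turningPoint c n ω) ξ : ℝ) * Complex.I) *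
          (((V (F.arrival n ω + q.1) : ℝ) : ℂ) *
            Complex.exp ((inner ℝ ((c * q.1) • q.2) ξ : ℝ) * Complex.I)) := fun q => by
      rw [inner_add_left, Complex.ofReal_add, add_mul, Complex.exp_add]
      ring
    simp_rw [e]
    rw [integral_const_mul, integral_cexp_expMeasure_prod hlam ξ
      (g := fun w => V (F.arrival n ω + w)) (ψ := fun w => c * w) (by fun_prop) (by fun_prop)
      (fun w => hVC _) (fun w hw => by positivity), ← integral_remainingTransform]
    congr 2
    refine setIntegral_congr_fun measurableSet_Ioi fun w hw => ?_
    simp only [V]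
    rw [if_pos (add_nonneg h0 (Set.mem_Ioi.1 hw).le), flightKernel_scale]
    simp [z]

theorem integral_turningPoint_remainingTransform [IsProbabilityMeasure P] (F : RandomFlight P 4 lam) (hlam : 0 < lam)
    {c : ℝ} (hc : 0 < c) (t : ℝ) (ξ : EuclideanSpace ℝ (Fin 4)) (m n : ℕ) :
    ∫ ω, Complex.exp ((inner ℝ (F.turningPoint c n ω) ξ : ℝ) * Complex.I) *
        (remainingTransform lam (c * (‖ξ‖ / 2)) t m (F.arrival n ω) : ℂ) ∂P =
      (remainingTransform lam (c * (‖ξ‖ / 2)) t (m + n) 0 : ℂ) := by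
  induction n generalizing m with
  | zero => simp [turningPoint, arrival]
  | succ n ih =>
    rw [F.integral_turningPoint_succ hlam hc, ih, show m + 1 + n = m + (n + 1) by ring]

/-- Averaging over the current leg gives its survival probability e^{-λ(t-s)} times a sphere
transform, which is `remainingTransform` with no switch. The completed legs are then absorbed one by
one, until n switches remain from time zero. -/
theorem setIntegral_countEvent [IsProbabilityMeasure P] (F : RandomFlight P 4 lam) (hlam : 0 < lam) {c : ℝ}
    (hc : 0 < c) {t : ℝ} (ht : 0 ≤ t) (ξ : EuclideanSpace ℝ (Fin 4)) (n : ℕ) :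
    ∫ ω in F.countEvent t n, Complex.exp ((inner ℝ (F.turningPoint c n ω +
        (c * (t - F.arrival n ω)) • F.dir n ω) ξ : ℝ) * Complex.I) ∂P =
      ((lam ^ n * Real.exp (-(lam * t)) * flightKernel (c * (‖ξ‖ / 2)) n t : ℝ) : ℂ) := by
  have hfin : (remainingTransform lam (c * (‖ξ‖ / 2)) t (0 + n) 0 : ℝ) =
      lam ^ n * Real.exp (-(lam * t)) * flightKernel (c * (‖ξ‖ / 2)) n t := by
    simp [remainingTransform, ht]
  rw [← hfin, ← F.integral_turningPoint_remainingTransform hlam hc t ξ 0 n,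
    ← integral_indicator (F.measurableSet_countEvent t n)]
  let A : Set ((EuclideanSpace ℝ (Fin 4) × ℝ) × (ℝ × EuclideanSpace ℝ (Fin 4))) :=
    {x | x.1.2 ≤ t ∧ t < x.1.2 + x.2.1}
  have hA : MeasurableSet A :=
    (measurableSet_le (measurable_snd.comp measurable_fst) measurable_const).inter
      (measurableSet_lt measurable_const ((measurable_snd.comp measurable_fst).add
        (measurable_fst.comp measurable_snd)))
  have h1 := F.integral_comp_turningPoint hlam c n
    (Φ := A.indicator fun x =>
      Complex.exp ((inner ℝ (x.1.1 + (c * (t - x.1.2)) • x.2.2) ξ : ℝ) * Complex.I))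
    (C := 1) (Measurable.indicator (by fun_prop) hA) (fun x => by
      refine (norm_indicator_le_norm_self _ _).trans_eq ?_
      exact Complex.norm_exp_ofReal_mul_I _)
  refine Eq.trans rfl (h1.trans (integral_congr_ae (ae_of_all _ fun ω => ?_)))
  -- The maximum keeps the radius nonnegative; it matters only when the arrival is after t, where
  -- the whole term is zero.
  have e : ∀ q : ℝ × EuclideanSpace ℝ (Fin 4), A.indicator (fun x =>
      Complex.exp ((inner ℝ (x.1.1 + (c * (t - x.1.2)) • x.2.2) ξ : ℝ) * Complex.I))
        ((F.turningPoint c n ω, F.arrival n ω), q) =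
      Complex.exp ((inner ℝ (F.turningPoint c n ω) ξ : ℝ) * Complex.I) *
        (((if F.arrival n ω ≤ t then (Set.Ioi (t - F.arrival n ω)).indicator 1 q.1 else 0 : ℝ) : ℂ) *
          Complex.exp ((inner ℝ ((c * max (t - F.arrival n ω) 0) • q.2) ξ : ℝ) * Complex.I)) :=
      fun q => by
    by_cases h : F.arrival n ω ≤ t
    · rw [if_pos h, max_eq_left (by linarith)]
      by_cases hq : t < F.arrival n ω + q.1
      · rw [Set.indicator_of_mem (show _ ∈ A from ⟨h, hq⟩),
          Set.indicator_of_mem (by rw [Set.mem_Ioi]; linarith),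
          inner_add_left, Complex.ofReal_add, add_mul, Complex.exp_add]
        simp
      · rw [Set.indicator_of_notMem (fun hx : _ ∈ A => hq hx.2),
          Set.indicator_of_notMem (by rw [Set.mem_Ioi]; linarith)]
        simp
    · rw [if_neg h, Set.indicator_of_notMem (fun hx : _ ∈ A => h hx.1)]
      simp
  simp_rw [e]
  rw [integral_const_mul, integral_cexp_expMeasure_prod hlam ξ (C := 1)
    (g := fun w => if F.arrival n ω ≤ t then (Set.Ioi (t - F.arrival n ω)).indicator 1 w else 0)
    (ψ := fun _ => c * max (t - F.arrival n ω) 0)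
    (by split_ifs
        · exact measurable_one.indicator measurableSet_Ioi
        · exact measurable_const) measurable_const
    (fun w => by
      split_ifs
      · by_cases hw : w ∈ Set.Ioi (t - F.arrival n ω) <;> simp [hw]
      · simp) (fun w _ => by positivity)]
  congr 2
  unfold remainingTransform
  by_cases h : F.arrival n ω ≤ t
  · simp only [if_pos h]
    rw [max_eq_left (by linarith), flightKernel_scale, pow_zero, one_mul]
    simp_rw [← mul_assoc]
    rw [integral_mul_const, integral_exp_Ioi_sub hlam (by linarith)]
    simp
  · simp [if_neg h]

end RandomFlight

/-! ### The exact law of the flight -/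

namespace RandomFlight

variable {Ω : Type*} [MeasurableSpace Ω] {P : Measure Ω} {lam : ℝ}

theorem count_eq_of_mem_countEvent (F : RandomFlight P 4 lam) {ω : Ω} (h : ∀ k, 0 ≤ F.wait k ω)
    {t : ℝ} {n : ℕ} (hn : ω ∈ F.countEvent t n) : F.count t ω = n := by
  have hmono := F.monotone_arrival h
  have hset : {k : ℕ | F.arrival (k + 1) ω ≤ t} = Set.Iio n := by
    ext k
    simp only [Set.mem_ofPred_eq, Set.mem_Iio]
    constructor
    · intro hk
      by_contra hnk
      have h1 : F.arrival (n + 1) ω ≤ F.arrival (k + 1) ω := hmono (by omega)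
      rw [arrival_succ] at h1
      linarith [hn.2]
    · intro hk
      exact (hmono (show k + 1 ≤ n by omega)).trans hn.1
  rw [count, hset, ← Finset.coe_Iio, Set.ncard_coe_finset, Nat.card_Iio]

theorem position_eq_of_mem_countEvent (F : RandomFlight P 4 lam) {ω : Ω}
    (h : ∀ k, 0 ≤ F.wait k ω) (c : ℝ) {t : ℝ} {n : ℕ} (hn : ω ∈ F.countEvent t n) :
    F.position c t ω = F.turningPoint c n ω + (c * (t - F.arrival n ω)) • F.dir n ω := by
  rw [position, F.count_eq_of_mem_countEvent h hn, turningPoint]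

theorem aedisjoint_countEvent (F : RandomFlight P 4 lam) (hlam : 0 < lam) (t : ℝ) :
    Pairwise (Function.onFun (AEDisjoint P) (F.countEvent t)) := by
  intro i j hij
  refine measure_mono_null (fun ω hω => ?_) (ae_iff.1 (F.ae_wait_nonneg hlam))
  intro h
  exact hij ((F.count_eq_of_mem_countEvent h hω.1).symm.trans
    (F.count_eq_of_mem_countEvent h hω.2))

theorem ae_mem_iUnion_countEvent [IsProbabilityMeasure P] (F : RandomFlight P 4 lam)
    (hlam : 0 < lam) {t : ℝ} (ht : 0 ≤ t) : ∀ᵐ ω ∂P, ω ∈ ⋃ n, F.countEvent t n := by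
  have h := hasSum_integral_iUnion_ae (μ := P) (f := fun _ => (1 : ℂ))
    (fun n => (F.measurableSet_countEvent t n).nullMeasurableSet)
    (F.aedisjoint_countEvent hlam t) (integrable_const _).integrableOn
  have h1 : ∀ n, ∫ ω in F.countEvent t n, (1 : ℂ) ∂P =
      ((lam ^ n * Real.exp (-(lam * t)) * (t ^ n / n.factorial) : ℝ) : ℂ) := fun n => by
    -- At frequency zero the transform is the probability of n switches, and the speed is
    -- immaterial. These Poisson weights sum to one, which excludes infinitely many switches.
    have := F.setIntegral_countEvent hlam one_pos ht 0 n
    simpa [flightKernel_zero] using this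
  simp_rw [h1] at h
  have h2 : HasSum (fun n : ℕ => lam ^ n * Real.exp (-(lam * t)) * (t ^ n / n.factorial)) 1 := by
    have h3 := (Real.hasSum_pow_div_factorial (lam * t)).mul_left (Real.exp (-(lam * t)))
    rw [← Real.exp_add, neg_add_cancel, Real.exp_zero] at h3
    convert! h3 using 2 with n
    rw [mul_pow]; ring
  have h4 := h.unique (Complex.hasSum_ofReal.2 h2)
  rw [setIntegral_const, Complex.real_smul, mul_one] at h4
  have h5 : P.real (⋃ n, F.countEvent t n) = 1 := Complex.ofReal_injective h4
  rw [Measure.real, ENNReal.toReal_eq_one_iff] at h5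
  exact (mem_ae_iff_prob_eq_one₀
    (NullMeasurableSet.iUnion fun n => (F.measurableSet_countEvent t n).nullMeasurableSet)).2 h5

theorem restrict_iUnion_countEvent [IsProbabilityMeasure P] (F : RandomFlight P 4 lam)
    (hlam : 0 < lam) {t : ℝ} (ht : 0 ≤ t) : P.restrict (⋃ n, F.countEvent t n) = P :=
  Measure.restrict_eq_self_of_ae_mem (F.ae_mem_iUnion_countEvent hlam ht)

/-- The position is glued from explicit measurable formulas on the events of n switches, which cover
the space up to a null set. -/
theorem aemeasurable_position [IsProbabilityMeasure P] (F : RandomFlight P 4 lam)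
    (hlam : 0 < lam) (c : ℝ) {t : ℝ} (ht : 0 ≤ t) : AEMeasurable (F.position c t) P := by
  suffices h : AEMeasurable (F.position c t) (P.restrict (⋃ n, F.countEvent t n)) by
    rwa [F.restrict_iUnion_countEvent hlam ht] at h
  rw [aemeasurable_iUnion_iff]
  intro n
  refine ⟨fun ω => F.turningPoint c n ω + (c * (t - F.arrival n ω)) • F.dir n ω, ?_, ?_⟩
  · exact (F.measurable_turningPoint c n).add
      ((((F.measurable_arrival n).const_sub t).const_mul c).smul (F.measurable_dir n))
  · filter_upwards [ae_restrict_of_ae (F.ae_wait_nonneg hlam),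
      ae_restrict_mem (F.measurableSet_countEvent t n)] with ω h hω
    exact F.position_eq_of_mem_countEvent h c hω

theorem hasSum_charFun_law [IsProbabilityMeasure P] (F : RandomFlight P 4 lam)
    (hlam : 0 < lam) {c t : ℝ} (hc : 0 < c) (ht : 0 ≤ t) (ξ : EuclideanSpace ℝ (Fin 4)) :
    HasSum (fun n : ℕ =>
      ((lam ^ n * Real.exp (-(lam * t)) * flightKernel (c * (‖ξ‖ / 2)) n t : ℝ) : ℂ))
      (charFun (F.law c t) ξ) := by
  have hm := F.aemeasurable_position hlam c ht
  have hint : Integrable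
      (fun ω => Complex.exp ((inner ℝ (F.position c t ω) ξ : ℝ) * Complex.I)) P :=
    Integrable.of_bound (C := 1) (AEMeasurable.aestronglyMeasurable (by fun_prop))
      (ae_of_all _ fun ω => (norm_cexp_inner_mul_I _ ξ).le)
  have h := hasSum_integral_iUnion_ae (μ := P)
    (fun n => (F.measurableSet_countEvent t n).nullMeasurableSet)
    (F.aedisjoint_countEvent hlam t) hint.integrableOn
  rw [F.restrict_iUnion_countEvent hlam ht] at h
  rw [charFun_apply, law, integral_map hm (Continuous.aestronglyMeasurable (by fun_prop))]
  convert! h using 2 with n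
  rw [← F.setIntegral_countEvent hlam hc ht ξ n]
  refine integral_congr_ae ?_
  filter_upwards [ae_restrict_of_ae (F.ae_wait_nonneg hlam),
    ae_restrict_mem (F.measurableSet_countEvent t n)] with ω h hω
  rw [F.position_eq_of_mem_countEvent h c hω]

/-- Both characteristic functions are series over n that agree termwise: rescaling the kernel from
ct to t produces c^n, and (λt/(ct))^n c^n = λ^n. -/
theorem law_eq_stationaryLaw [IsProbabilityMeasure P] (F : RandomFlight P 4 lam)
    (hlam : 0 < lam) {c t : ℝ} (hc : 0 < c) (ht : 0 < t) :
    F.law c t = stationaryLaw (lam * t) (c * t) := by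
  have := isProbabilityMeasure_stationaryLaw (mul_pos hlam ht) (mul_pos hc ht)
  have : IsFiniteMeasure (F.law c t) := by unfold law; infer_instance
  refine Measure.ext_of_charFun (funext fun ξ => ?_)
  refine (F.hasSum_charFun_law hlam hc ht.le ξ).unique ?_
  convert! hasSum_charFun_stationaryLaw (mul_pos hlam ht) (mul_pos hc ht) ξ using 3 with n
  rw [flightKernel_scale, mul_div_mul_right _ _ ht.ne', div_pow]
  field_simp

end RandomFlight

/-! ### Continuity in the parameters and the limit theorem -/

theorem continuousAt_stationaryACDensity (a : ℝ) {ϱ : ℝ} (hϱ : 0 < ϱ)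
    {x : EuclideanSpace ℝ (Fin 4)} (hx : ‖x‖ ≠ ϱ) :
    ContinuousAt (fun p : ℝ × ℝ => stationaryACDensity p.1 p.2 x) (a, ϱ) := by
  have hsnd : Tendsto (fun p : ℝ × ℝ => p.2) (𝓝 (a, ϱ)) (𝓝 ϱ) := continuousAt_snd
  rcases lt_or_gt_of_ne hx with h | h
  · have hc : ContinuousAt (fun p : ℝ × ℝ =>
        p.1 / (Real.pi ^ 2 * p.2 ^ 4) * (2 + p.1 * (1 - ‖x‖ ^ 2 / p.2 ^ 2)) *
          Real.exp (-(p.1 / p.2 ^ 2) * ‖x‖ ^ 2)) (a, ϱ) := by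
      have h1 : (Real.pi ^ 2 * (a, ϱ).2 ^ 4 : ℝ) ≠ 0 := by positivity
      have h2 : ((a, ϱ).2 ^ 2 : ℝ) ≠ 0 := by positivity
      fun_prop (disch := assumption)
    refine hc.congr ?_
    filter_upwards [hsnd.eventually (lt_mem_nhds h)] with p hp
    rw [stationaryACDensity, if_pos hp]
  · refine (continuousAt_const (y := (0 : ℝ))).congr ?_
    filter_upwards [hsnd.eventually (gt_mem_nhds h)] with p hp
    rw [stationaryACDensity, if_neg hp.not_gt]

/-- Pulling back to the unit sphere moves the radius from the measure into the integrand, where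
dominated convergence applies. -/
theorem continuous_integral_stationarySingularPart (f : EuclideanSpace ℝ (Fin 4) →ᵇ ℝ) :
    Continuous fun p : ℝ × ℝ => ∫ x, f x ∂(stationarySingularPart p.1 p.2) := by
  simp_rw [integral_stationarySingularPart,
    integral_uniformSphere_eq 4 _ f.continuous.stronglyMeasurable]
  have h : Continuous fun p : ℝ × ℝ => ∫ x, f (p.2 • x) ∂(uniformSphere 4 1) := by
    refine continuous_of_dominated (bound := fun _ => ‖f‖)
      (fun p => Continuous.aestronglyMeasurable (by fun_prop))
      (fun p => ae_of_all _ fun x => f.norm_coe_le_norm _) (integrable_const _)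
      (ae_of_all _ fun x => by fun_prop)
  fun_prop

theorem continuousAt_integral_stationaryACDensity {a ϱ : ℝ} (ha : 0 < a) (hϱ : 0 < ϱ)
    (f : EuclideanSpace ℝ (Fin 4) →ᵇ ℝ) :
    ContinuousAt (fun p : ℝ × ℝ => ∫ x, stationaryACDensity p.1 p.2 x • f x) (a, ϱ) := by
  -- K bounds the densities whose parameters lie in (0, a + 1) and (ϱ/2, ϱ + 1), and their supports
  -- lie in the ball of radius ϱ + 1. Pointwise continuity fails at most on the null sphere ‖x‖ = ϱ.
  let K : ℝ := (a + 1) / (Real.pi ^ 2 * (ϱ / 2) ^ 4) * (2 + (a + 1))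
  have hfst : Tendsto (fun p : ℝ × ℝ => p.1) (𝓝 (a, ϱ)) (𝓝 a) := continuousAt_fst
  have hsnd : Tendsto (fun p : ℝ × ℝ => p.2) (𝓝 (a, ϱ)) (𝓝 ϱ) := continuousAt_snd
  have h0 : ∀ᵐ x : EuclideanSpace ℝ (Fin 4), ‖x‖ ≠ ϱ := by
    have : (volume : Measure (EuclideanSpace ℝ (Fin 4))) (Metric.sphere 0 ϱ) = 0 :=
      Measure.addHaar_sphere _ _ _
    rw [ae_iff]
    refine measure_mono_null (fun x hx => ?_) this
    simpa using hx
  refine continuousAt_of_dominated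
    (bound := (Metric.ball 0 (ϱ + 1)).indicator fun _ => K * ‖f‖) ?_ ?_ ?_ ?_
  · exact Eventually.of_forall fun p => ((measurable_stationaryACDensity p.1 p.2).smul
      f.continuous.measurable).aestronglyMeasurable
  · filter_upwards [hfst.eventually (lt_mem_nhds ha),
      hfst.eventually (gt_mem_nhds (lt_add_one a)),
      hsnd.eventually (lt_mem_nhds (half_lt_self hϱ)),
      hsnd.eventually (gt_mem_nhds (lt_add_one ϱ))] with p h1 h2 h3 h4
    refine ae_of_all _ fun x => ?_
    have hle := stationaryACDensity_le h1.le p.2 x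
    have hn := stationaryACDensity_nonneg h1.le p.2 x
    rw [norm_smul, Real.norm_of_nonneg hn]
    by_cases hx : x ∈ Metric.ball (0 : EuclideanSpace ℝ (Fin 4)) p.2
    · rw [Set.indicator_of_mem hx] at hle
      rw [Set.indicator_of_mem (Metric.ball_subset_ball h4.le hx)]
      refine mul_le_mul (hle.trans ?_) (f.norm_coe_le_norm x) (norm_nonneg _) (by positivity)
      simp only [K]
      gcongr
    · rw [Set.indicator_of_notMem hx] at hle
      rw [le_antisymm hle hn, zero_mul]
      exact Set.indicator_nonneg (fun _ _ => by positivity) _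
  · exact (integrable_indicator_iff measurableSet_ball).2
      (integrableOn_const measure_ball_lt_top.ne)
  · filter_upwards [h0] with x hx
    exact (continuousAt_stationaryACDensity a hϱ hx).smul continuousAt_const

theorem integral_bcf_stationaryLaw {a : ℝ} (ha : 0 ≤ a) (ϱ : ℝ)
    (f : EuclideanSpace ℝ (Fin 4) →ᵇ ℝ) :
    ∫ x, f x ∂(stationaryLaw a ϱ) = ∫ x, f x ∂(stationarySingularPart a ϱ) +
      ∫ x, stationaryACDensity a ϱ x • f x :=
  integral_stationaryLaw ha ϱ f.continuous.stronglyMeasurable f.norm_coe_le_norm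

theorem continuousAt_integral_stationaryLaw {a ϱ : ℝ} (ha : 0 < a) (hϱ : 0 < ϱ)
    (f : EuclideanSpace ℝ (Fin 4) →ᵇ ℝ) :
    ContinuousAt (fun p : ℝ × ℝ => ∫ x, f x ∂(stationaryLaw p.1 p.2)) (a, ϱ) := by
  have hfst : Tendsto (fun p : ℝ × ℝ => p.1) (𝓝 (a, ϱ)) (𝓝 a) := continuousAt_fst
  refine ((continuous_integral_stationarySingularPart f).continuousAt.add
    (continuousAt_integral_stationaryACDensity ha hϱ f)).congr ?_
  filter_upwards [hfst.eventually (lt_mem_nhds ha)] with p hp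
  exact (integral_bcf_stationaryLaw hp.le p.2 f).symm

/-- Spheres are Lebesgue null, so the defining sum is already the Lebesgue decomposition, which is
unique. -/
theorem singularPart_stationaryLaw (a : ℝ) {ϱ : ℝ} (hϱ : 0 ≤ ϱ) :
    (stationaryLaw a ϱ).singularPart volume = stationarySingularPart a ϱ :=
  (Measure.eq_singularPart (measurable_stationaryACDensity a ϱ).ennreal_ofReal
    ((uniformSphere_mutuallySingular 4 hϱ).smul _) rfl).symm

theorem isACDensity_stationaryLaw {a ϱ : ℝ} (ha : 0 ≤ a) (hϱ : 0 < ϱ) :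
    IsACDensity (stationaryLaw a ϱ) ϱ (stationaryACDensity a ϱ) where
  continuousOn := by
    have h2 : ϱ ^ 2 ≠ 0 := by positivity
    have hc : Continuous fun x : EuclideanSpace ℝ (Fin 4) =>
        a / (Real.pi ^ 2 * ϱ ^ 4) * (2 + a * (1 - ‖x‖ ^ 2 / ϱ ^ 2)) *
          Real.exp (-(a / ϱ ^ 2) * ‖x‖ ^ 2) := by fun_prop
    refine hc.continuousOn.congr fun x hx => ?_
    rw [stationaryACDensity, if_pos (by simpa using hx)]
  nonneg := stationaryACDensity_nonneg ha ϱ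
  eq_zero x hx := by rw [stationaryACDensity, if_neg hx.not_gt]
  decomposition := by rw [singularPart_stationaryLaw a hϱ.le]; rfl

theorem mainTheorem3 {ι : Type*} {l : Filter ι} {Ω : ι → Type*} [∀ i, MeasurableSpace (Ω i)]
    (P : ∀ i, Measure (Ω i)) [∀ i, IsProbabilityMeasure (P i)]
    (lam c t : ι → ℝ) (hlam : ∀ i, 0 < lam i) (hc : ∀ i, 0 < c i) (ht : ∀ i, 0 < t i)
    (F : ∀ i, RandomFlight (P i) 4 (lam i))
    (a ϱ : ℝ) (ha : 0 < a) (hϱ : 0 < ϱ)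
    (hlam_lim : Tendsto lam l (𝓝 0)) (hc_lim : Tendsto c l (𝓝 0)) (ht_lim : Tendsto t l atTop)
    (hlamt_lim : Tendsto (fun i => lam i * t i) l (𝓝 a))
    (hct_lim : Tendsto (fun i => c i * t i) l (𝓝 ϱ)) :
    -- the limit is a probability distribution, and the laws converge to it weakly
    IsProbabilityMeasure (stationaryLaw a ϱ) ∧
    (∀ φ : EuclideanSpace ℝ (Fin 4) →ᵇ ℝ,
      Tendsto (fun i => ∫ x, φ x ∂((F i).law (c i) (t i))) l
        (𝓝 (∫ x, φ x ∂(stationaryLaw a ϱ)))) ∧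
    -- the singular components converge weakly to the singular component of the limit
    (∀ φ : EuclideanSpace ℝ (Fin 4) →ᵇ ℝ,
      Tendsto (fun i => ∫ x, φ x ∂(((F i).law (c i) (t i)).singularPart volume)) l
        (𝓝 (∫ x, φ x ∂(stationarySingularPart a ϱ)))) ∧
    -- the absolutely continuous components have densities that converge pointwise
    (∃ p : ι → EuclideanSpace ℝ (Fin 4) → ℝ,
      (∀ i, IsACDensity ((F i).law (c i) (t i)) (c i * t i) (p i)) ∧
      ∀ x : EuclideanSpace ℝ (Fin 4), ‖x‖ ≠ ϱ →
        Tendsto (fun i => p i x) l (𝓝 (stationaryACDensity a ϱ x))) := by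
  -- Each law is a member of the explicit family, so every limit is continuity of that family at (a,
  -- ϱ).
  have hlaw : ∀ i, (F i).law (c i) (t i) = stationaryLaw (lam i * t i) (c i * t i) := fun i =>
    (F i).law_eq_stationaryLaw (hlam i) (hc i) (ht i)
  have hsing : ∀ i, ((F i).law (c i) (t i)).singularPart volume =
      stationarySingularPart (lam i * t i) (c i * t i) := fun i => by
    rw [hlaw, singularPart_stationaryLaw _ (mul_pos (hc i) (ht i)).le]
  have hlim : Tendsto (fun i => (lam i * t i, c i * t i)) l (𝓝 (a, ϱ)) :=
    hlamt_lim.prodMk_nhds hct_lim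
  refine ⟨isProbabilityMeasure_stationaryLaw ha hϱ, fun φ => ?_, fun φ => ?_,
    fun i => stationaryACDensity (lam i * t i) (c i * t i), fun i => ?_, fun x hx => ?_⟩
  · have h := (continuousAt_integral_stationaryLaw ha hϱ φ).tendsto.comp hlim
    simp only [Function.comp_def] at h
    simp only [hlaw]
    exact h
  · have h := (continuous_integral_stationarySingularPart φ).continuousAt.tendsto.comp hlim
    simp only [Function.comp_def] at h
    simp only [hsing]
    exact h
  · rw [hlaw]
    exact isACDensity_stationaryLaw (mul_pos (hlam i) (ht i)).le (mul_pos (hc i) (ht i))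
  · exact (continuousAt_stationaryACDensity a hϱ hx).tendsto.comp hlim
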